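/- Let $k$ be a field and $H$ a Hopf algebra over $k$ with bijective antipode $S$; write $\Delta(h)=h_1\otimes h_2$. For Hopf algebra automorphisms $\alpha,\beta$ of $H$, an $(\alpha,\beta)$-Yetter-Drinfeld module is a vector space $M$ that is a left $H$-module and a right $H$-comodule ($m\mapsto m_{(0)}\otimes m_{(1)}$) with $$(h\cdot m)_{(0)}\otimes(h\cdot m)_{(1)}=h_2\cdot m_{(0)}\otimes\beta(h_3)\,m_{(1)}\,\alpha(S^{-1}(h_1)).$$ They form a category ${}_H\mathcal{YD}^H(\alpha,\beta)$ with the $H$-linear $H$-colinear maps as morphisms, and ${}_H\mathcal{YD}^H={}_H\mathcal{YD}^H(\mathrm{id},\mathrm{id})$. Let $G=\mathrm{Aut}_{Hopf}(H)\times\mathrm{Aut}_{Hopf}(H)$ with $(\alpha,\beta)*(\gamma,\delta)=(\alpha\gamma,\delta\gamma^{-1}\beta\gamma)$; it is a group with unit $(\mathrm{id},\mathrm{id})$ and $(\alpha,\beta)^{-1}=(\alpha^{-1},\alpha\beta^{-1}\alpha^{-1})$. Let $M$ and $N$ be Yetter-Drinfeld modules over $(\alpha,\beta)$ and $(\gamma,\delta)$,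 and let $(\mu,\nu)\in G$. Define * $M\otimes N$, over $(\alpha,\beta)*(\gamma,\delta)$, with $h\cdot(m\otimes n)=\gamma(h_1)\cdot m\otimes\gamma^{-1}\beta\gamma(h_2)\cdot n$ and $m\otimes n\mapsto (m_{(0)}\otimes n_{(0)})\otimes n_{(1)}m_{(1)}$; the unit object is $k$ with $h\cdot 1=\varepsilon(h)$, $1\mapsto 1\otimes 1$, over $(\mathrm{id},\mathrm{id})$; * ${}^{(\mu,\nu)}N$, over $(\mu,\nu)*(\gamma,\delta)*(\mu,\nu)^{-1}$: the space $N$ with $h\rightharpoonup n=\gamma^{-1}\nu\gamma\mu^{-1}(h)\cdot n$ and $n\mapsto n_{(0)}\otimes\mu\nu^{-1}(n_{(1)})$; put ${}^MN={}^{(\alpha,\beta)}N$; * $c_{M,N}:M\otimes N\to{}^MN\otimes M$, $c_{M,N}(m\otimes n)=n_{(0)}\otimes\beta^{-1}(n_{(1)})\cdot m$. **Theorem.** Let $M\in{}_H\mathcal{YD}^H(\alpha,\beta)$ be finite dimensional, with dual bases $\{e_i\}$ of $M$ and $\{e^i\}$ of $\mathrm{Hom}(M,k)$. (1) $M^*=\mathrm{Hom}(M,k)$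 is an object of ${}_H\mathcal{YD}^H(\alpha^{-1},\alpha\beta^{-1}\alpha^{-1})$ with $(h\cdot f)(m)=f(\beta^{-1}\alpha^{-1}S(h)\cdot m)$ and $f_{(0)}(m)\otimes f_{(1)}=f(m_{(0)})\otimes S^{-1}(m_{(1)})$. The maps $b_M:k\to M\otimes M^*$, $b_M(1)=\sum_ie_i\otimes e^i$, and $d_M:M^*\otimes M\to k$, $d_M(f\otimes m)=f(m)$, are morphisms in ${}_H\mathcal{YD}^H$, and $(\mathrm{id}_M\otimes d_M)(b_M\otimes\mathrm{id}_M)=\mathrm{id}_M$, $(d_M\otimes\mathrm{id}_{M^*})(\mathrm{id}_{M^*}\otimes b_M)=\mathrm{id}_{M^*}$. (2) ${}^*M=\mathrm{Hom}(M,k)$ is an object of ${}_H\mathcal{YD}^H(\alpha^{-1},\alpha\beta^{-1}\alpha^{-1})$ with $(h\cdot f)(m)=f(\beta^{-1}\alpha^{-1}S^{-1}(h)\cdot m)$ and $f_{(0)}(m)\otimes f_{(1)}=f(m_{(0)})\otimes S(m_{(1)})$. The maps $b_M:k\to{}^*M\otimes M$, $b_M(1)=\sum_ie^i\otimes e_i$,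 and $d_M:M\otimes{}^*M\to k$, $d_M(m\otimes f)=f(m)$, are morphisms in ${}_H\mathcal{YD}^H$, and $(d_M\otimes\mathrm{id}_M)(\mathrm{id}_M\otimes b_M)=\mathrm{id}_M$, $(\mathrm{id}_{{}^*M}\otimes d_M)(b_M\otimes\mathrm{id}_{{}^*M})=\mathrm{id}_{{}^*M}$. (3) Let $\mathcal{YD}(H)_{fd}$ be the disjoint union, over $(\alpha,\beta)\in G$, of the categories of finite-dimensional $(\alpha,\beta)$-Yetter-Drinfeld modules. With the tensor product above (and the usual associativity and unit constraints of vector spaces), the conjugation $\varphi_{(\mu,\nu)}(N)={}^{(\mu,\nu)}N$, acting as the identity on morphisms, and the braiding $c_{M,N}$, it is a braided T-category over $G$ with left and right dualities, given by (1) and (2). That is: it is a monoidal category whose tensor product multiplies the degrees in $G$; $\varphi$ is a homomorphism from $G$ to the group of invertible strict tensor endofunctors, with $\varphi_g$ mapping the component of $g'$ to that of $gg'g^{-1}$; the $c_{M,N}$ are isomorphisms, natural in $M$ and $N$, with (up to associativity constraints) $c_{M\otimes N,P}=(c_{M,{}^NP}\otimes\mathrm{id}_N)(\mathrm{id}_M\otimes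 c_{N,P})$, $c_{M,N\otimes P}=(\mathrm{id}_{{}^MN}\otimes c_{M,P})(c_{M,N}\otimes\mathrm{id}_P)$ and $\varphi_g(c_{M,N})=c_{\varphi_g(M),\varphi_g(N)}$; the duals of objects of degree $g$ have degree $g^{-1}$, their evaluations and coevaluations are morphisms satisfying the zigzag identities, and the choice of duals, evaluations and coevaluations is stable under every $\varphi_g$. -/

import Mathlib

open CategoryTheory MonoidalCategory
open scoped TensorProduct

universe u v w w₁ w₂

noncomputable section

/-! ### The group `G = Aut_Hopf(H) × Aut_Hopf(H)` with its twisted multiplication -/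

/-- Hopf algebra automorphisms (a bialgebra map between Hopf algebras automatically commutes with
the antipodes), with composition as multiplication: `(α * β) h = α (β h)`. -/
instance instGroupBialgAut (k : Type u) (H : Type v) [Field k] [Ring H] [HopfAlgebra k H] :
    Group (H ≃ₐc[k] H) where
  mul f g := g.trans f
  one := BialgEquiv.refl k H
  inv f := f.symm
  mul_assoc _ _ _ := rfl
  one_mul _ := rfl
  mul_one _ := rfl
  inv_mul_cancel f := BialgEquiv.ext fun x => f.symm_apply_apply x

/-- Pairs `(α, β)` of Hopf algebra automorphisms of `H`. -/
@[ext]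
structure AutPair (k : Type u) (H : Type v) [Field k] [Ring H] [HopfAlgebra k H] where
  /-- the first automorphism -/
  fst : H ≃ₐc[k] H
  /-- the second automorphism -/
  snd : H ≃ₐc[k] H

/-- `(α, β) * (γ, δ) = (αγ, δ γ⁻¹ β γ)`, with unit `(id, id)` and inverse
`(α, β)⁻¹ = (α⁻¹, α β⁻¹ α⁻¹)`. -/
instance instGroupAutPair (k : Type u) (H : Type v) [Field k] [Ring H] [HopfAlgebra k H] :
    Group (AutPair k H) where
  mul p q := ⟨p.fst * q.fst, q.snd * q.fst⁻¹ * p.snd * q.fst⟩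
  one := ⟨1, 1⟩
  inv p := ⟨p.fst⁻¹, p.fst * p.snd⁻¹ * p.fst⁻¹⟩
  mul_assoc p q r := AutPair.ext (mul_assoc _ _ _) (by
    change r.snd * r.fst⁻¹ * (q.snd * q.fst⁻¹ * p.snd * q.fst) * r.fst
      = r.snd * r.fst⁻¹ * q.snd * r.fst * (q.fst * r.fst)⁻¹ * p.snd * (q.fst * r.fst)
    group)
  one_mul p := AutPair.ext (one_mul _) (by
    change p.snd * p.fst⁻¹ * 1 * p.fst = p.snd
    group)
  mul_one p := AutPair.ext (mul_one _) (by
    change 1 * 1⁻¹ * p.snd * 1 = p.snd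
    group)
  inv_mul_cancel p := AutPair.ext (inv_mul_cancel p.fst) (by
    change p.snd * p.fst⁻¹ * (p.fst * p.snd⁻¹ * p.fst⁻¹) * p.fst = 1
    group)

/-- A Hopf automorphism as a `k`-linear map. -/
abbrev autLin {k : Type u} {H : Type v} [Field k] [Ring H] [HopfAlgebra k H] (f : H ≃ₐc[k] H) :
    H →ₗ[k] H :=
  ((f : H →ₐc[k] H) : H →ₗ[k] H)

/-- The inverse `S⁻¹` of the bijective antipode. -/
def antipodeInv (k : Type u) (H : Type v) [Field k] [Ring H] [HopfAlgebra k H]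
    [hS : Fact (Function.Bijective (HopfAlgebra.antipode k (A := H)))] : H →ₗ[k] H :=
  (LinearEquiv.ofBijective (HopfAlgebra.antipode k (A := H)) hS.out).symm.toLinearMap

/-! ### `(α, β)`-Yetter-Drinfeld modules -/

/-- Raw data: a vector space `M` with a pair `(α, β)`, an "action" `h ⊗ m ↦ h · m` and a
"coaction" `m ↦ m₀ ⊗ m₁`. The axioms are imposed by `YDDatum.IsYD`. -/
structure YDDatum (k : Type u) (H : Type v) [Field k] [Ring H] [HopfAlgebra k H] where
  /-- the underlying vector space -/
  carrier : Type w
  [addCommGroup : AddCommGroup carrier]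
  [module : Module k carrier]
  /-- the pair `(α, β)` -/
  deg : AutPair k H
  /-- the action of `H` -/
  act : H →ₗ[k] carrier →ₗ[k] carrier
  /-- the coaction of `H` -/
  coact : carrier →ₗ[k] carrier ⊗[k] H

attribute [instance] YDDatum.addCommGroup YDDatum.module

namespace YDDatum

variable {k : Type u} {H : Type v} [Field k] [Ring H] [HopfAlgebra k H]

/-- `c ⊗ a ↦ (x ↦ β(c) x α(S⁻¹(a)))`. -/
def sandwich [Fact (Function.Bijective (HopfAlgebra.antipode k (A := H)))] (g : AutPair k H) :
    H ⊗[k] H →ₗ[k] H →ₗ[k] H :=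
  TensorProduct.lift
    ((LinearMap.llcomp k H H H).compl₁₂ (LinearMap.mul k H ∘ₗ autLin g.snd)
      ((LinearMap.mul k H).flip ∘ₗ autLin g.fst ∘ₗ antipodeInv k H))

/-- `a ⊗ (b ⊗ c) ↦ (m ⊗ x ↦ b · m ⊗ β(c) x α(S⁻¹(a)))`. -/
def compatMap [Fact (Function.Bijective (HopfAlgebra.antipode k (A := H)))]
    (D : YDDatum.{u, v, w} k H) :
    H ⊗[k] (H ⊗[k] H) →ₗ[k] D.carrier ⊗[k] H →ₗ[k] D.carrier ⊗[k] H :=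
  TensorProduct.homTensorHomMap (.id k) D.carrier H D.carrier H ∘ₗ
    TensorProduct.map D.act (sandwich D.deg) ∘ₗ
    (TensorProduct.assoc k H H H).toLinearMap ∘ₗ (TensorProduct.comm k H (H ⊗[k] H)).toLinearMap

theorem compatMap_tmul [Fact (Function.Bijective (HopfAlgebra.antipode k (A := H)))]
    (D : YDDatum.{u, v, w} k H) (a b c x : H) (m : D.carrier) :
    D.compatMap (a ⊗ₜ (b ⊗ₜ c)) (m ⊗ₜ x) =
      D.act b m ⊗ₜ (D.deg.snd c * (x * D.deg.fst (antipodeInv k H a))) := rfl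

/-- `D` is an `(α, β)`-Yetter-Drinfeld module, where `(α, β) = D.deg`: a left `H`-module and a
right `H`-comodule with
`(h · m)₀ ⊗ (h · m)₁ = h₂ · m₀ ⊗ β(h₃) m₁ α(S⁻¹(h₁))`. -/
structure IsYD [Fact (Function.Bijective (HopfAlgebra.antipode k (A := H)))]
    (D : YDDatum.{u, v, w} k H) : Prop where
  one_act : ∀ m : D.carrier, D.act 1 m = m
  mul_act : ∀ (h l : H) (m : D.carrier), D.act (h * l) m = D.act h (D.act l m)
  coassoc : ∀ m : D.carrier,
    TensorProduct.assoc k D.carrier H H (D.coact.rTensor H (D.coact m)) =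
      (Coalgebra.comul (R := k) (A := H)).lTensor D.carrier (D.coact m)
  counit : ∀ m : D.carrier,
    (Coalgebra.counit (R := k) (A := H)).lTensor D.carrier (D.coact m) = m ⊗ₜ[k] (1 : k)
  compat : ∀ (h : H) (m : D.carrier),
    D.coact (D.act h m) =
      D.compatMap ((Coalgebra.comul (R := k) (A := H)).lTensor H (Coalgebra.comul h)) (D.coact m)

/-- Morphisms: `H`-linear `H`-colinear maps inside one component. Different components of the
disjoint union have no morphisms between them. -/
structure IsMor (D : YDDatum.{u, v, w₁} k H) (E : YDDatum.{u, v, w₂} k H)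
    (φ : D.carrier →ₗ[k] E.carrier) : Prop where
  deg_eq : D.deg = E.deg
  map_act : ∀ (h : H) (m : D.carrier), φ (D.act h m) = E.act h (φ m)
  map_coact : ∀ m : D.carrier, E.coact (φ m) = φ.rTensor H (D.coact m)

/-- The unit object `k`: `h · 1 = ε(h)`, `1 ↦ 1 ⊗ 1`, in the component of `(id, id)`. -/
@[reducible]
def unit (k : Type u) (H : Type v) [Field k] [Ring H] [HopfAlgebra k H] : YDDatum.{u, v, u} k H where
  carrier := k
  deg := ⟨1, 1⟩
  act := LinearMap.mul k k ∘ₗ Coalgebra.counit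
  coact := (TensorProduct.mk k k H).flip 1

/-- `M ⊗ N`, for `M` over `(α, β)` and `N` over `(γ, δ)`:
`h · (m ⊗ n) = γ(h₁) · m ⊗ γ⁻¹βγ(h₂) · n` and `m ⊗ n ↦ (m₀ ⊗ n₀) ⊗ n₁ m₁`, over
`(αγ, δ γ⁻¹ β γ)`. -/
@[reducible]
def tensor (D : YDDatum.{u, v, w₁} k H) (E : YDDatum.{u, v, w₂} k H) :
    YDDatum.{u, v, max w₁ w₂} k H where
  carrier := D.carrier ⊗[k] E.carrier
  deg := ⟨D.deg.fst * E.deg.fst, E.deg.snd * E.deg.fst⁻¹ * D.deg.snd * E.deg.fst⟩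
  act := TensorProduct.homTensorHomMap (.id k) D.carrier E.carrier D.carrier E.carrier ∘ₗ
    TensorProduct.map (D.act ∘ₗ autLin E.deg.fst)
      (E.act ∘ₗ autLin (E.deg.fst⁻¹ * D.deg.snd * E.deg.fst)) ∘ₗ
    Coalgebra.comul
  coact :=
    (LinearMap.mul' k H ∘ₗ (TensorProduct.comm k H H).toLinearMap).lTensor
        (D.carrier ⊗[k] E.carrier) ∘ₗ
      (TensorProduct.tensorTensorTensorComm k D.carrier H E.carrier H).toLinearMap ∘ₗ
      TensorProduct.map D.coact E.coact

/-- `^{(α, β)}N`, for `N` over `(γ, δ)`: the space `N` with `h ⇀ n = γ⁻¹βγα⁻¹(h) · n` and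
`n ↦ n₀ ⊗ αβ⁻¹(n₁)`, over `(αγα⁻¹, αβ⁻¹δγ⁻¹βγα⁻¹)`. -/
@[reducible]
def twist (g : AutPair k H) (D : YDDatum.{u, v, w} k H) : YDDatum.{u, v, w} k H where
  carrier := D.carrier
  deg := ⟨g.fst * D.deg.fst * g.fst⁻¹,
    g.fst * g.snd⁻¹ * D.deg.snd * D.deg.fst⁻¹ * g.snd * D.deg.fst * g.fst⁻¹⟩
  act := D.act ∘ₗ autLin (D.deg.fst⁻¹ * g.snd * D.deg.fst * g.fst⁻¹)
  coact := (autLin (g.fst * g.snd⁻¹)).lTensor D.carrier ∘ₗ D.coact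

/-- `c_{M,N} : M ⊗ N → ^M N ⊗ M`, `m ⊗ n ↦ n₀ ⊗ β⁻¹(n₁) · m`, for `M` over `(α, β)`. -/
def braid (D : YDDatum.{u, v, w₁} k H) (E : YDDatum.{u, v, w₂} k H) :
    D.carrier ⊗[k] E.carrier →ₗ[k] E.carrier ⊗[k] D.carrier :=
  (TensorProduct.lift (D.act ∘ₗ autLin D.deg.snd⁻¹)).lTensor E.carrier ∘ₗ
    (TensorProduct.assoc k E.carrier H D.carrier).toLinearMap ∘ₗ
    E.coact.rTensor D.carrier ∘ₗ
    (TensorProduct.comm k D.carrier E.carrier).toLinearMap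

/-- For a finite-dimensional `M` and a linear `T : H → H`, the map `M^* → M^* ⊗ H`,
`f ↦ f₀ ⊗ f₁`, determined by `f₀(m) ⊗ f₁ = f(m₀) ⊗ T(m₁)`
(an element `∑ fᵢ ⊗ hᵢ` of `M^* ⊗ H` is identified with the map `m ↦ ∑ fᵢ(m) hᵢ`). -/
def dualCoact (D : YDDatum.{u, v, w} k H) [Module.Finite k D.carrier] (T : H →ₗ[k] H) :
    Module.Dual k D.carrier →ₗ[k] Module.Dual k D.carrier ⊗[k] H :=
  (dualTensorHomEquiv k D.carrier H).symm.toLinearMap ∘ₗ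
    (LinearMap.llcomp k D.carrier (D.carrier ⊗[k] H) H).flip D.coact ∘ₗ
    (LinearMap.llcomp k (D.carrier ⊗[k] H) (k ⊗[k] H) H
      (T ∘ₗ (TensorProduct.lid k H).toLinearMap)) ∘ₗ
    LinearMap.rTensorHom H

theorem dualCoact_apply (D : YDDatum.{u, v, w} k H) [Module.Finite k D.carrier] (T : H →ₗ[k] H)
    (f : Module.Dual k D.carrier) (m : D.carrier) :
    dualTensorHom k D.carrier H (D.dualCoact T f) m =
      T (TensorProduct.lid k H (f.rTensor H (D.coact m))) := by
  change dualTensorHomEquiv k D.carrier H ((dualTensorHomEquiv k D.carrier H).symm _) m = _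
  rw [LinearEquiv.apply_symm_apply]
  rfl

/-- `M^* = Hom(M, k)`: `(h · f)(m) = f(β⁻¹α⁻¹S(h) · m)`, `f₀(m) ⊗ f₁ = f(m₀) ⊗ S⁻¹(m₁)`, over
`(α⁻¹, αβ⁻¹α⁻¹)`. -/
@[reducible]
def leftDual [Fact (Function.Bijective (HopfAlgebra.antipode k (A := H)))]
    (D : YDDatum.{u, v, w} k H) [Module.Finite k D.carrier] :
    YDDatum.{u, v, max u w} k H where
  carrier := Module.Dual k D.carrier
  deg := ⟨D.deg.fst⁻¹, D.deg.fst * D.deg.snd⁻¹ * D.deg.fst⁻¹⟩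
  act := Module.Dual.transpose (R := k) ∘ₗ D.act ∘ₗ autLin (D.deg.snd⁻¹ * D.deg.fst⁻¹) ∘ₗ
    HopfAlgebra.antipode k
  coact := D.dualCoact (antipodeInv k H)

/-- `^*M = Hom(M, k)`: `(h · f)(m) = f(β⁻¹α⁻¹S⁻¹(h) · m)`, `f₀(m) ⊗ f₁ = f(m₀) ⊗ S(m₁)`, over
`(α⁻¹, αβ⁻¹α⁻¹)`. -/
@[reducible]
def rightDual [Fact (Function.Bijective (HopfAlgebra.antipode k (A := H)))]
    (D : YDDatum.{u, v, w} k H) [Module.Finite k D.carrier] :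
    YDDatum.{u, v, max u w} k H where
  carrier := Module.Dual k D.carrier
  deg := ⟨D.deg.fst⁻¹, D.deg.fst * D.deg.snd⁻¹ * D.deg.fst⁻¹⟩
  act := Module.Dual.transpose (R := k) ∘ₗ D.act ∘ₗ autLin (D.deg.snd⁻¹ * D.deg.fst⁻¹) ∘ₗ
    antipodeInv k H
  coact := D.dualCoact (HopfAlgebra.antipode k)

/-- `b_M : k → M ⊗ M^*`, `1 ↦ ∑ eᵢ ⊗ eⁱ`. -/
def leftCoev (D : YDDatum.{u, v, w} k H) [Module.Finite k D.carrier] :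
    k →ₗ[k] D.carrier ⊗[k] Module.Dual k D.carrier :=
  coevaluation k D.carrier

/-- `d_M : M^* ⊗ M → k`, `f ⊗ m ↦ f(m)`. -/
def leftEv (D : YDDatum.{u, v, w} k H) : Module.Dual k D.carrier ⊗[k] D.carrier →ₗ[k] k :=
  contractLeft k D.carrier

/-- `b_M : k → ^*M ⊗ M`, `1 ↦ ∑ eⁱ ⊗ eᵢ`. -/
def rightCoev (D : YDDatum.{u, v, w} k H) [Module.Finite k D.carrier] :
    k →ₗ[k] Module.Dual k D.carrier ⊗[k] D.carrier :=
  (TensorProduct.comm k D.carrier (Module.Dual k D.carrier)).toLinearMap ∘ₗ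
    coevaluation k D.carrier

/-- `d_M : M ⊗ ^*M → k`, `m ⊗ f ↦ f(m)`. -/
def rightEv (D : YDDatum.{u, v, w} k H) : D.carrier ⊗[k] Module.Dual k D.carrier →ₗ[k] k :=
  contractRight k D.carrier

/-- Equal data have the same underlying space. -/
def castEquiv {D E : YDDatum.{u, v, w} k H} (h : D = E) : D.carrier ≃ₗ[k] E.carrier := by
  subst h
  exact LinearEquiv.refl k D.carrier

end YDDatum

/-! ### The category `𝒴𝒟(H)_fd` -/

/-- Finite-dimensional objects of the disjoint union of all the categories of `(α, β)`-Yetter-Drinfeld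
modules. -/
structure YDfd (k : Type u) (H : Type v) [Field k] [Ring H] [HopfAlgebra k H]
    [Fact (Function.Bijective (HopfAlgebra.antipode k (A := H)))] where
  /-- the underlying datum -/
  datum : YDDatum.{u, v, u} k H
  isYD : datum.IsYD
  finite : Module.Finite k datum.carrier

attribute [instance] YDfd.finite

namespace YDfd

variable {k : Type u} {H : Type v} [Field k] [Ring H] [HopfAlgebra k H]
  [Fact (Function.Bijective (HopfAlgebra.antipode k (A := H)))]

/-- Morphisms of `𝒴𝒟(H)_fd`. -/
@[ext]
structure Hom (X Y : YDfd k H) where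
  /-- the underlying linear map -/
  lin : X.datum.carrier →ₗ[k] Y.datum.carrier
  isMor : YDDatum.IsMor X.datum Y.datum lin

instance instCategory : Category (YDfd k H) where
  Hom X Y := Hom X Y
  id X := ⟨LinearMap.id, rfl, fun _ _ => rfl, fun m => by simp⟩
  comp f g := ⟨g.lin ∘ₗ f.lin, f.isMor.deg_eq.trans g.isMor.deg_eq,
    fun h m => by simp [f.isMor.map_act, g.isMor.map_act],
    fun m => by simp [f.isMor.map_coact, g.isMor.map_coact, LinearMap.rTensor_comp]⟩

/-- The underlying linear map of a morphism. -/
def lin {X Y : YDfd k H} (f : X ⟶ Y) : X.datum.carrier →ₗ[k] Y.datum.carrier := Hom.lin f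

/-- The source of `f` is the object with datum `D`, its target the object with datum `E`, and its
underlying map is `φ`. -/
def IsGivenBy {X Y : YDfd k H} (f : X ⟶ Y) (D E : YDDatum.{u, v, u} k H)
    (φ : D.carrier →ₗ[k] E.carrier) : Prop :=
  ∃ (hD : X.datum = D) (hE : Y.datum = E),
    ∀ x : X.datum.carrier, YDDatum.castEquiv hE (lin f x) = φ (YDDatum.castEquiv hD x)

end YDfd

/-! ### Braided T-categories with dualities -/

/-- A strict tensor functor: it preserves the unit object, the tensor products of objects and of
morphisms, and the associativity and unit constraints, on the nose. -/
structure IsStrictTensorFunctor {C : Type*} [Category C] [MonoidalCategory C] (F : C ⥤ C) :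
    Prop where
  obj_unit : F.obj (𝟙_ C) = 𝟙_ C
  obj_tensor : ∀ X Y : C, F.obj (X ⊗ Y) = F.obj X ⊗ F.obj Y
  map_tensor : ∀ {X Y X' Y' : C} (f : X ⟶ Y) (f' : X' ⟶ Y'),
    F.map (f ⊗ₘ f') =
      eqToHom (obj_tensor X X') ≫ (F.map f ⊗ₘ F.map f') ≫ eqToHom (obj_tensor Y Y').symm
  map_associator : ∀ X Y Z : C,
    F.map (α_ X Y Z).hom =
      eqToHom (by rw [obj_tensor, obj_tensor]) ≫ (α_ (F.obj X) (F.obj Y) (F.obj Z)).hom ≫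
        eqToHom (by rw [obj_tensor, obj_tensor])
  map_leftUnitor : ∀ X : C,
    F.map (λ_ X).hom = eqToHom (by rw [obj_tensor, obj_unit]) ≫ (λ_ (F.obj X)).hom
  map_rightUnitor : ∀ X : C,
    F.map (ρ_ X).hom = eqToHom (by rw [obj_tensor, obj_unit]) ≫ (ρ_ (F.obj X)).hom

/-- A T-category over the group `G`: a tensor category which is the disjoint union of
subcategories `C_g` (the full subcategory on the objects with `deg X = g`), `g ∈ G`, with
`C_g ⊗ C_h ⊆ C_{gh}`, and a group homomorphism `conj` from `G` to the invertible strict tensor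
endofunctors with `conj g (C_h) = C_{g h g⁻¹}`. -/
structure TCategory (G : Type*) [Group G] (C : Type*) [Category C] [MonoidalCategory C] where
  /-- the component of an object -/
  deg : C → G
  deg_eq_of_hom : ∀ {X Y : C}, (X ⟶ Y) → deg X = deg Y
  deg_unit : deg (𝟙_ C) = 1
  deg_tensor : ∀ X Y : C, deg (X ⊗ Y) = deg X * deg Y
  /-- the conjugation -/
  conj : G → C ⥤ C
  conj_strict : ∀ g : G, IsStrictTensorFunctor (conj g)
  conj_one : conj 1 = 𝟭 C
  conj_mul : ∀ g h : G, conj (g * h) = conj h ⋙ conj g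
  deg_conj : ∀ (g : G) (X : C), deg ((conj g).obj X) = g * deg X * g⁻¹

namespace TCategory

variable {G : Type*} [Group G] {C : Type*} [Category C] [MonoidalCategory C]

/-- `^X Y`, the conjugate of `Y` by the component of `X`. -/
abbrev conjObj (T : TCategory G C) (X Y : C) : C := (T.conj (T.deg X)).obj Y

theorem conjObj_eq_of_hom (T : TCategory G C) {X X' : C} (f : X ⟶ X') (Y : C) :
    T.conjObj X Y = T.conjObj X' Y := by
  rw [conjObj, conjObj, T.deg_eq_of_hom f]

theorem conjObj_conjObj (T : TCategory G C) (X Y Z : C) :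
    T.conjObj X (T.conjObj Y Z) = T.conjObj (X ⊗ Y) Z := by
  rw [conjObj, conjObj, conjObj, T.deg_tensor, T.conj_mul]
  rfl

theorem conjObj_tensor (T : TCategory G C) (X Y Z : C) :
    T.conjObj X Y ⊗ T.conjObj X Z = T.conjObj X (Y ⊗ Z) :=
  ((T.conj_strict _).obj_tensor Y Z).symm

theorem conj_conjObj (T : TCategory G C) (g : G) (X Y : C) :
    (T.conj g).obj (T.conjObj X Y) = T.conjObj ((T.conj g).obj X) ((T.conj g).obj Y) := by
  have h : ∀ a b : G, (T.conj a).obj ((T.conj b).obj Y) = (T.conj (a * b)).obj Y := fun a b => by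
    rw [T.conj_mul]
    rfl
  rw [conjObj, conjObj, T.deg_conj, h, h, inv_mul_cancel_right]

/-- A braiding in a T-category: isomorphisms `c_{X,Y} : X ⊗ Y → ^X Y ⊗ X`, natural, compatible
with tensor products and stable under conjugation. -/
structure Braiding (T : TCategory G C) where
  /-- the isomorphisms `c_{X,Y}` -/
  c : ∀ X Y : C, X ⊗ Y ≅ T.conjObj X Y ⊗ X
  naturality : ∀ {X X' Y Y' : C} (f : X ⟶ X') (g : Y ⟶ Y'),
    (f ⊗ₘ g) ≫ (c X' Y').hom =
      (c X Y).hom ≫ ((T.conj (T.deg X)).map g ⊗ₘ f) ≫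
        eqToHom (by rw [← T.conjObj_eq_of_hom f])
  tensor_left : ∀ X Y Z : C,
    (c (X ⊗ Y) Z).hom =
      (α_ X Y Z).hom ≫ X ◁ (c Y Z).hom ≫ (α_ X (T.conjObj Y Z) Y).inv ≫
        (c X (T.conjObj Y Z)).hom ▷ Y ≫ (α_ (T.conjObj X (T.conjObj Y Z)) X Y).hom ≫
        eqToHom (by rw [T.conjObj_conjObj])
  tensor_right : ∀ X Y Z : C,
    (c X (Y ⊗ Z)).hom =
      (α_ X Y Z).inv ≫ (c X Y).hom ▷ Z ≫ (α_ (T.conjObj X Y) X Z).hom ≫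
        T.conjObj X Y ◁ (c X Z).hom ≫ (α_ (T.conjObj X Y) (T.conjObj X Z) X).inv ≫
        eqToHom (by rw [T.conjObj_tensor])
  conj_c : ∀ (g : G) (X Y : C),
    (T.conj g).map (c X Y).hom =
      eqToHom ((T.conj_strict g).obj_tensor X Y) ≫
        (c ((T.conj g).obj X) ((T.conj g).obj Y)).hom ≫
        eqToHom (by rw [(T.conj_strict g).obj_tensor, T.conj_conjObj])

/-- A left duality of a T-category: for each `X` an object `X^*` of the inverse component, with
`b_X : 𝟙 → X ⊗ X^*` and `d_X : X^* ⊗ X → 𝟙` satisfying the zigzag identities, stable under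
conjugation. -/
structure LeftDuality (T : TCategory G C) where
  /-- the left dual -/
  dual : C → C
  /-- coevaluation and evaluation with the zigzag identities -/
  pairing : ∀ X : C, ExactPairing X (dual X)
  deg_dual : ∀ X : C, T.deg (dual X) = (T.deg X)⁻¹
  conj_dual : ∀ (g : G) (X : C), (T.conj g).obj (dual X) = dual ((T.conj g).obj X)
  conj_coev : ∀ (g : G) (X : C),
    (T.conj g).map (pairing X).coevaluation' =
      eqToHom (T.conj_strict g).obj_unit ≫ (pairing ((T.conj g).obj X)).coevaluation' ≫
        eqToHom (by rw [(T.conj_strict g).obj_tensor, conj_dual])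
  conj_ev : ∀ (g : G) (X : C),
    (T.conj g).map (pairing X).evaluation' =
      eqToHom (by rw [(T.conj_strict g).obj_tensor, conj_dual]) ≫
        (pairing ((T.conj g).obj X)).evaluation' ≫ eqToHom (T.conj_strict g).obj_unit.symm

/-- A right duality of a T-category: for each `X` an object `^*X` of the inverse component, with
`b_X : 𝟙 → ^*X ⊗ X` and `d_X : X ⊗ ^*X → 𝟙` satisfying the zigzag identities, stable under
conjugation. -/
structure RightDuality (T : TCategory G C) where
  /-- the right dual -/
  dual : C → C
  /-- coevaluation and evaluation with the zigzag identities -/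
  pairing : ∀ X : C, ExactPairing (dual X) X
  deg_dual : ∀ X : C, T.deg (dual X) = (T.deg X)⁻¹
  conj_dual : ∀ (g : G) (X : C), (T.conj g).obj (dual X) = dual ((T.conj g).obj X)
  conj_coev : ∀ (g : G) (X : C),
    (T.conj g).map (pairing X).coevaluation' =
      eqToHom (T.conj_strict g).obj_unit ≫ (pairing ((T.conj g).obj X)).coevaluation' ≫
        eqToHom (by rw [(T.conj_strict g).obj_tensor, conj_dual])
  conj_ev : ∀ (g : G) (X : C),
    (T.conj g).map (pairing X).evaluation' =
      eqToHom (by rw [(T.conj_strict g).obj_tensor, conj_dual]) ≫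
        (pairing ((T.conj g).obj X)).evaluation' ≫ eqToHom (T.conj_strict g).obj_unit.symm

end TCategory

end

/-!
For a vector space `M` with an action and a coaction, multiplying the Yetter-Drinfeld condition for
`h₂` by `α(h₁)` and cancelling `S⁻¹(h₂) h₁` gives the equivalent condition without the antipode
`h₁ · m₀ ⊗ β(h₂) m₁ = (h₂ · m)₀ ⊗ (h₂ · m)₁ α(h₁)`
(`YDDatum.IsCrossed`, with `YDDatum.isCrossed_of_compat` and `YDDatum.IsCrossed.compat`), which says
that an element of `H` can be moved past a coaction. All constructions are verified in this form.

* Tensor products: `h` is moved past the coaction of `n` and then past that of `m`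
  (`YDDatum.IsCrossed.tensor`).
* Braiding: `c_{M,N}` is linear by the crossed condition of `N` and colinear by that of `M`
  (`YDDatum.isMor_braid`). Its inverse replaces `n₁` by `S(n₁)` (`YDDatum.braidEquiv`), and the two
  hexagons follow from the coassociativity of the third object and from the definition of the
  coaction on a tensor product (`YDDatum.braid_tensor_left`, `YDDatum.braid_tensor_right`).
* Duals: `S` and `S⁻¹` both reverse products and coproducts and commute with Hopf automorphisms.
  For a pair `(T, T')` of such maps (`IsAntiPair`) the dual space has an action through `T'` and a
  coaction through `T`, and its crossed condition is the transpose of that of `M`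
  (`IsAntiPair.isYD_dual`); the pairs `(S⁻¹, S)` and `(S, S⁻¹)` give `M^*` and `^*M`. Evaluation and
  coevaluation are morphisms because `h₁ ⊗ h₂` and `m₁ ⊗ m₂` collapse under `S` or `S⁻¹`
  (`YDDatum.IsYD.isMor_leftEv` and its companions), and the zigzag identities are those of
  vector spaces.
* Conjugation: `^g M` has the same space as `M`, and identities in the group of Hopf automorphisms
  show that conjugation preserves the unit object, tensor products, duals and braidings, and is
  multiplicative in `g` (`YDDatum.twist_tensor`, `YDDatum.twist_mul`, `IsAntiPair.twist_dual`,
  `YDDatum.braid_twist`). These are equalities of data, so that the identities between morphisms of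
  the T-category hold up to morphisms `eqToHom`. They are proved by comparing underlying linear maps
  heterogeneously (`YDDatum.SameSpace`, `YDfd.eq_eqToHom_comp_eqToHom`).
-/

noncomputable section

/-! ### Hopf automorphisms and the antipode -/

section HopfAut

variable {k : Type u} {H : Type v} [Field k] [Ring H] [HopfAlgebra k H]

open Coalgebra

@[simp]
theorem bialgAut_mul_apply (f g : H ≃ₐc[k] H) (x : H) : (f * g) x = f (g x) := rfl

@[simp]
theorem bialgAut_inv_apply_self (f : H ≃ₐc[k] H) (x : H) : f⁻¹ (f x) = x :=
  f.symm_apply_apply x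

@[simp]
theorem bialgAut_apply_inv_self (f : H ≃ₐc[k] H) (x : H) : f (f⁻¹ x) = x :=
  f.apply_symm_apply x

@[simp]
theorem autLin_apply (f : H ≃ₐc[k] H) (x : H) : autLin f x = f x := rfl

theorem comul_aut (f : H ≃ₐc[k] H) (x : H) :
    comul (R := k) (f x) = TensorProduct.map (autLin f) (autLin f) (comul (R := k) x) :=
  (CoalgHomClass.map_comp_comul_apply f x).symm

@[simp]
theorem counit_aut (f : H ≃ₐc[k] H) (x : H) : counit (R := k) (f x) = counit (R := k) x :=
  CoalgHomClass.counit_comp_apply f x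

/-- Bialgebra automorphisms commute with the antipode: `f ∘ S` and `S ∘ f` are both convolution
inverse to `f`. -/
theorem aut_antipode (f : H ≃ₐc[k] H) (x : H) :
    f (HopfAlgebra.antipode k x) = HopfAlgebra.antipode k (f x) := by
  have key : WithConv.toConv (autLin f ∘ₗ HopfAlgebra.antipode k) =
      WithConv.toConv (HopfAlgebra.antipode k ∘ₗ autLin f) := by
    refine (left_inv_eq_right_inv (a := WithConv.toConv (autLin f)) ?_ ?_).symm
    · ext h
      rw [(ℛ k h).convMul_apply]
      have := HopfAlgebra.mul_antipode_rTensor_comul_apply (R := k) (f h)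
      rw [comul_aut, ← (ℛ k h).eq] at this
      simpa [map_sum] using this
    · ext h
      rw [(ℛ k h).convMul_apply]
      have := congrArg f (HopfAlgebra.sum_mul_antipode_eq_algebraMap_counit (ℛ k h))
      simpa [map_sum, AlgHomClass.commutes] using this
  exact congr($(key).ofConv x)

/-- The antipode reverses the comultiplication: both `Δ ∘ S` and `h ↦ S(h₂) ⊗ S(h₁)` are
convolution inverse to `Δ`. -/
theorem comul_antipode (h : H) :
    comul (R := k) (HopfAlgebra.antipode k h) =
      TensorProduct.map (HopfAlgebra.antipode k) (HopfAlgebra.antipode k)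
        (TensorProduct.comm k H H (comul (R := k) h)) := by
  let S : H →ₗ[k] H := HopfAlgebra.antipode k
  let G : H →ₗ[k] H ⊗[k] H :=
    TensorProduct.map S S ∘ₗ (TensorProduct.comm k H H).toLinearMap ∘ₗ comul
  -- `S(b₁) b₂ ⊗ b₃ = 1 ⊗ b`
  have inner : ∀ b : H, ∑ j ∈ (ℛ k b).index,
      (S ((ℛ k b).left j) ⊗ₜ[k] (1 : H)) * comul (R := k) ((ℛ k b).right j) = 1 ⊗ₜ[k] b := by
    intro b
    have h1 := congrArg (((LinearMap.mul' k H ∘ₗ S.rTensor H).rTensor H) ∘ₗ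
      (TensorProduct.assoc k H H H).symm.toLinearMap) (Coalgebra.coassoc_apply (R := k) b)
    simp only [LinearMap.comp_apply, LinearEquiv.coe_coe, LinearEquiv.symm_apply_apply] at h1
    rw [← (ℛ k b).eq] at h1
    have h2 : ∀ (a : H) (u : H ⊗[k] H),
        (LinearMap.mul' k H ∘ₗ S.rTensor H).rTensor H
          ((TensorProduct.assoc k H H H).symm (a ⊗ₜ[k] u)) = (S a ⊗ₜ[k] (1 : H)) * u := by
      intro a u
      induction u with
      | zero => simp
      | tmul x y => simp
      | add x y hx hy => rw [TensorProduct.tmul_add, map_add, map_add, hx, hy, mul_add]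
    simp only [map_sum, LinearMap.rTensor_tmul, LinearMap.lTensor_tmul, h2,
      LinearMap.comp_apply, S, HopfAlgebra.mul_antipode_rTensor_comul_apply] at h1
    rw [← h1]
    have h3 := Coalgebra.rTensor_counit_comul (R := k) b
    rw [← (ℛ k b).eq] at h3
    have h4 := congrArg (LinearMap.rTensor H (Algebra.linearMap k H)) h3
    simpa only [map_sum, LinearMap.rTensor_tmul, Algebra.linearMap_apply, map_one] using h4
  -- `S(h₂) h₃ ⊗ S(h₁) h₄` collapses to `1 ⊗ S(h₁) h₂ = ε(h)`, so `G` is a left inverse of `Δ`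
  have key : WithConv.toConv G = WithConv.toConv (comul (R := k) ∘ₗ S) := by
    refine left_inv_eq_right_inv (a := WithConv.toConv (comul (R := k) (A := H))) ?_
      LinearMap.comul_right_inv
    ext h
    rw [(ℛ k h).convMul_apply]
    have h2 : ∀ (u : H ⊗[k] H) (b : H), TensorProduct.map S S (TensorProduct.comm k H H u) *
        comul (R := k) b = LinearMap.mul' k (H ⊗[k] H)
          (TensorProduct.map ((TensorProduct.mk k H H 1) ∘ₗ S) (LinearMap.mul' k (H ⊗[k] H) ∘ₗ
            TensorProduct.map ((TensorProduct.mk k H H).flip 1 ∘ₗ S) comul)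
            (TensorProduct.assoc k H H H (u ⊗ₜ[k] b))) := by
      intro u b
      induction u with
      | zero => simp
      | tmul x y => simp [← mul_assoc]
      | add x y hx hy => simp only [TensorProduct.add_tmul, map_add, add_mul, hx, hy]
    have h3 : ∀ b : H, (LinearMap.mul' k (H ⊗[k] H) ∘ₗ
            TensorProduct.map ((TensorProduct.mk k H H).flip 1 ∘ₗ S) comul)
            (comul (R := k) b) = 1 ⊗ₜ[k] b := by
      intro b
      rw [← inner b]
      conv_lhs => rw [← (ℛ k b).eq]
      simp [map_sum]
    have h1 := Coalgebra.coassoc_apply (R := k) h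
    rw [← (ℛ k h).eq] at h1
    simp only [map_sum, LinearMap.rTensor_tmul, LinearMap.lTensor_tmul] at h1
    have h4 := congrArg (fun t => LinearMap.mul' k (H ⊗[k] H)
          (TensorProduct.map ((TensorProduct.mk k H H 1) ∘ₗ S) (LinearMap.mul' k (H ⊗[k] H) ∘ₗ
            TensorProduct.map ((TensorProduct.mk k H H).flip 1 ∘ₗ S) comul) t)) h1
    simp only [map_sum, ← h2, TensorProduct.map_tmul, h3] at h4
    have h5 := congrArg (TensorProduct.mk k H H 1)
      (HopfAlgebra.sum_antipode_mul_eq_algebraMap_counit (ℛ k h))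
    simp only [G, LinearMap.comp_apply, LinearEquiv.coe_coe]
    rw [h4]
    simp only [map_sum] at h5
    simpa [S, Algebra.TensorProduct.one_def, TensorProduct.tmul_smul,
      Algebra.algebraMap_eq_smul_one] using h5
  exact congr($(key.symm).ofConv h)

variable [hS : Fact (Function.Bijective (HopfAlgebra.antipode k (A := H)))]

@[simp]
theorem antipode_antipodeInv (x : H) : HopfAlgebra.antipode k (antipodeInv k H x) = x :=
  (LinearEquiv.ofBijective (HopfAlgebra.antipode k (A := H)) hS.out).apply_symm_apply x

@[simp]
theorem antipodeInv_antipode (x : H) : antipodeInv k H (HopfAlgebra.antipode k x) = x :=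
  (LinearEquiv.ofBijective (HopfAlgebra.antipode k (A := H)) hS.out).symm_apply_apply x

/-- Linear maps `T`, `T'` with `T ∘ T' = id` and the properties shared by `S` and `S⁻¹`: they
reverse products and coproducts and commute with all Hopf automorphisms. Both `(S⁻¹, S)` and
`(S, S⁻¹)` are such pairs, so a construction from `(T, T')` treats left and right duals at
once. -/
structure IsAntiPair (T T' : H →ₗ[k] H) : Prop where
  left_inv : ∀ x, T (T' x) = x
  mul : ∀ x y, T (x * y) = T y * T x
  mul' : ∀ x y, T' (x * y) = T' y * T' x
  one' : T' 1 = 1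
  counit : ∀ x, counit (R := k) (T x) = counit (R := k) x
  comul : ∀ x, comul (R := k) (T x) =
    TensorProduct.map T T (TensorProduct.comm k H H (comul (R := k) x))
  comul' : ∀ x, Coalgebra.comul (R := k) (T' x) =
    TensorProduct.map T' T' (TensorProduct.comm k H H (Coalgebra.comul (R := k) x))
  aut : ∀ (f : H ≃ₐc[k] H) x, f (T x) = T (f x)
  aut' : ∀ (f : H ≃ₐc[k] H) x, f (T' x) = T' (f x)

theorem antipodeInv_mul (x y : H) :
    antipodeInv k H (x * y) = antipodeInv k H y * antipodeInv k H x := by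
  apply hS.out.injective
  simp [HopfAlgebra.antipode_mul_antidistrib]

theorem antipodeInv_one : antipodeInv k H 1 = 1 := by
  apply hS.out.injective
  simp

theorem counit_antipodeInv (x : H) :
    counit (R := k) (antipodeInv k H x) = counit (R := k) x := by
  rw [← HopfAlgebra.counit_antipode (R := k), antipode_antipodeInv]

theorem aut_antipodeInv (f : H ≃ₐc[k] H) (x : H) :
    f (antipodeInv k H x) = antipodeInv k H (f x) := by
  apply hS.out.injective
  simp [← aut_antipode]

theorem comul_antipodeInv (x : H) :
    comul (R := k) (antipodeInv k H x) =
      TensorProduct.map (antipodeInv k H) (antipodeInv k H)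
        (TensorProduct.comm k H H (comul (R := k) x)) := by
  conv_rhs => rw [← antipode_antipodeInv (k := k) x, comul_antipode]
  generalize comul (R := k) (antipodeInv k H x) = u
  induction u with
  | zero => simp
  | tmul x y => simp
  | add x y hx hy => simp only [map_add, ← hx, ← hy]

theorem isAntiPair_antipodeInv : IsAntiPair (antipodeInv k H) (HopfAlgebra.antipode k) :=
  ⟨antipodeInv_antipode, antipodeInv_mul, HopfAlgebra.antipode_mul_antidistrib,
    HopfAlgebra.antipode_one,
    counit_antipodeInv, comul_antipodeInv, comul_antipode, aut_antipodeInv, aut_antipode⟩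

theorem isAntiPair_antipode : IsAntiPair (HopfAlgebra.antipode k) (antipodeInv k H) :=
  ⟨antipode_antipodeInv, HopfAlgebra.antipode_mul_antidistrib, antipodeInv_mul, antipodeInv_one,
    HopfAlgebra.counit_antipode, comul_antipode, comul_antipodeInv, aut_antipode, aut_antipodeInv⟩

/-- `S⁻¹(h₂) h₁ = ε(h)`. -/
theorem antipodeInv_right_mul_left (h : H) :
    LinearMap.mul' k H ((antipodeInv k H).rTensor H
      (TensorProduct.comm k H H (comul (R := k) h))) = algebraMap k H (counit (R := k) h) := by
  apply hS.out.injective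
  have h1 := HopfAlgebra.mul_antipode_rTensor_comul_apply (R := k) h
  have h2 : HopfAlgebra.antipode k (algebraMap k H (counit (R := k) h)) =
      algebraMap k H (counit (R := k) h) := by
    simp [Algebra.algebraMap_eq_smul_one]
  rw [h2, ← h1]
  generalize comul (R := k) h = u
  induction u with
  | zero => simp
  | tmul x y => simp [HopfAlgebra.antipode_mul_antidistrib]
  | add x y hx hy => simp only [map_add, hx, hy]

/-- `h₂ S⁻¹(h₁) = ε(h)`. -/
theorem right_mul_antipodeInv_left (h : H) :
    LinearMap.mul' k H ((antipodeInv k H).lTensor H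
      (TensorProduct.comm k H H (comul (R := k) h))) = algebraMap k H (counit (R := k) h) := by
  apply hS.out.injective
  have h1 := HopfAlgebra.mul_antipode_lTensor_comul_apply (R := k) h
  have h2 : HopfAlgebra.antipode k (algebraMap k H (counit (R := k) h)) =
      algebraMap k H (counit (R := k) h) := by
    simp [Algebra.algebraMap_eq_smul_one]
  rw [h2, ← h1]
  generalize comul (R := k) h = u
  induction u with
  | zero => simp
  | tmul x y => simp [HopfAlgebra.antipode_mul_antidistrib]
  | add x y hx hy => simp only [map_add, hx, hy]

end HopfAut

namespace YDDatum

open Coalgebra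

variable {k : Type u} {H : Type v} [Field k] [Ring H] [HopfAlgebra k H]

/-! ### The crossed form of the Yetter-Drinfeld condition -/

/-- `x ↦ (m ⊗ y ↦ m ⊗ y x)`. -/
def mulCoeff (k : Type u) (H : Type v) [Field k] [Ring H] [HopfAlgebra k H] (M : Type w)
    [AddCommGroup M] [Module k M] : H →ₗ[k] M ⊗[k] H →ₗ[k] M ⊗[k] H :=
  LinearMap.lTensorHom M ∘ₗ (LinearMap.mul k H).flip

@[simp]
theorem mulCoeff_tmul (M : Type w) [AddCommGroup M] [Module k M] (x y : H) (m : M) :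
    mulCoeff k H M x (m ⊗ₜ y) = m ⊗ₜ (y * x) := rfl

theorem mulCoeff_mulCoeff (M : Type w) [AddCommGroup M] [Module k M] (x y : H) (t : M ⊗[k] H) :
    mulCoeff k H M x (mulCoeff k H M y t) = mulCoeff k H M (y * x) t := by
  induction t with
  | zero => simp
  | tmul m z => simp [mul_assoc]
  | add s t hs ht => simp only [map_add, hs, ht]

theorem mulCoeff_algebraMap (M : Type w) [AddCommGroup M] [Module k M] (c : k) (t : M ⊗[k] H) :
    mulCoeff k H M (algebraMap k H c) t = c • t := by
  induction t with
  | zero => simp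
  | tmul m z => simp [← Algebra.commutes, ← Algebra.smul_def]
  | add s t hs ht => simp only [map_add, hs, ht, smul_add]

/-- `a ⊗ b ↦ (m ⊗ x ↦ a · m ⊗ β(b) x)`. -/
def actMul (D : YDDatum.{u, v, w} k H) :
    H ⊗[k] H →ₗ[k] D.carrier ⊗[k] H →ₗ[k] D.carrier ⊗[k] H :=
  TensorProduct.homTensorHomMap (.id k) D.carrier H D.carrier H ∘ₗ
    TensorProduct.map D.act (LinearMap.mul k H ∘ₗ autLin D.deg.snd)

@[simp]
theorem actMul_tmul (D : YDDatum.{u, v, w} k H) (a b x : H) (m : D.carrier) :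
    D.actMul (a ⊗ₜ b) (m ⊗ₜ x) = D.act a m ⊗ₜ (D.deg.snd b * x) := rfl

/-- `a ⊗ b ↦ (m ↦ (b · m)₀ ⊗ (b · m)₁ α(a))`. -/
def coactMul (D : YDDatum.{u, v, w} k H) : H ⊗[k] H →ₗ[k] D.carrier →ₗ[k] D.carrier ⊗[k] H :=
  TensorProduct.lift
    ((LinearMap.llcomp k D.carrier (D.carrier ⊗[k] H) (D.carrier ⊗[k] H)).compl₁₂
      (mulCoeff k H D.carrier ∘ₗ autLin D.deg.fst)
      (LinearMap.llcomp k D.carrier D.carrier (D.carrier ⊗[k] H) D.coact ∘ₗ D.act))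

@[simp]
theorem coactMul_tmul (D : YDDatum.{u, v, w} k H) (a b : H) (m : D.carrier) :
    D.coactMul (a ⊗ₜ b) m = mulCoeff k H D.carrier (D.deg.fst a) (D.coact (D.act b m)) := rfl

/-- The crossed form of the Yetter-Drinfeld condition, without the antipode:
`h₁ · m₀ ⊗ β(h₂) m₁ = (h₂ · m)₀ ⊗ (h₂ · m)₁ α(h₁)`. -/
def IsCrossed (D : YDDatum.{u, v, w} k H) : Prop :=
  ∀ (h : H) (m : D.carrier), D.actMul (comul h) (D.coact m) = D.coactMul (comul h) m

section compat

variable [Fact (Function.Bijective (HopfAlgebra.antipode k (A := H)))]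

theorem compatMap_tmul_left (D : YDDatum.{u, v, w} k H) (a : H) (u : H ⊗[k] H)
    (t : D.carrier ⊗[k] H) : D.compatMap (a ⊗ₜ u) t =
      mulCoeff k H D.carrier (D.deg.fst (antipodeInv k H a)) (D.actMul u t) := by
  induction u with
  | zero => simp
  | add u v hu hv => simp only [TensorProduct.tmul_add, map_add, LinearMap.add_apply, hu, hv]
  | tmul b c =>
    induction t with
    | zero => simp
    | add s t hs ht => simp only [map_add, hs, ht]
    | tmul m x => simp [compatMap_tmul, mul_assoc]

/-- In a Yetter-Drinfeld module, `(h₂ · m)₀ ⊗ (h₂ · m)₁ α(h₁)` expands to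
`h₃ · m₀ ⊗ β(h₄) m₁ α(S⁻¹(h₂) h₁)`, where `S⁻¹(h₂) h₁` collapses. -/
theorem isCrossed_of_compat (D : YDDatum.{u, v, w} k H)
    (hD : ∀ (h : H) (m : D.carrier), D.coact (D.act h m) =
      D.compatMap ((comul (R := k) (A := H)).lTensor H (comul h)) (D.coact m)) :
    D.IsCrossed := by
  intro h m
  let T : (H ⊗[k] H) ⊗[k] H →ₗ[k] D.carrier ⊗[k] H := TensorProduct.lift
    ((mulCoeff k H D.carrier).compl₁₂
      (autLin D.deg.fst ∘ₗ LinearMap.mul' k H ∘ₗ (antipodeInv k H).rTensor H ∘ₗ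
        (TensorProduct.comm k H H).toLinearMap)
      (D.actMul.flip (D.coact m) ∘ₗ comul))
  have h1 : ∀ u : H ⊗[k] H, D.coactMul u m =
      T ((TensorProduct.assoc k H H H).symm (comul.lTensor H u)) := by
    intro u
    induction u with
    | zero => simp
    | add u v hu hv => simp only [map_add, LinearMap.add_apply, hu, hv]
    | tmul a b =>
      rw [coactMul_tmul, hD, LinearMap.lTensor_tmul]
      generalize comul (R := k) b = v
      induction v with
      | zero => simp
      | add u v hu hv => simp only [map_add, LinearMap.add_apply, hu, hv, TensorProduct.tmul_add]
      | tmul b c => simp [T, compatMap_tmul_left, mulCoeff_mulCoeff]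
  have h2 : ∀ u : H ⊗[k] H, T (comul.rTensor H u) =
      D.actMul (comul (TensorProduct.lid k H (counit.rTensor H u))) (D.coact m) := by
    intro u
    induction u with
    | zero => simp
    | add u v hu hv => simp only [map_add, LinearMap.add_apply, hu, hv]
    | tmul a b =>
      simp [T, antipodeInv_right_mul_left, AlgHomClass.commutes, mulCoeff_algebraMap]
  rw [h1, Coalgebra.coassoc_symm_apply, h2]
  simp

/-- The crossed form implies the Yetter-Drinfeld condition, since `h₂ S⁻¹(h₁)` collapses in
`h₂ · m₀ ⊗ β(h₃) m₁ α(S⁻¹(h₁)) = (h₃ · m)₀ ⊗ (h₃ · m)₁ α(h₂ S⁻¹(h₁))`. -/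
theorem IsCrossed.compat {D : YDDatum.{u, v, w} k H} (hD : D.IsCrossed) (h : H)
    (m : D.carrier) : D.coact (D.act h m) =
      D.compatMap ((comul (R := k) (A := H)).lTensor H (comul h)) (D.coact m) := by
  let T : (H ⊗[k] H) ⊗[k] H →ₗ[k] D.carrier ⊗[k] H := TensorProduct.lift
    ((mulCoeff k H D.carrier).compl₁₂
      (autLin D.deg.fst ∘ₗ LinearMap.mul' k H ∘ₗ (antipodeInv k H).lTensor H ∘ₗ
        (TensorProduct.comm k H H).toLinearMap)
      (D.coact ∘ₗ D.act.flip m))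
  have h1 : ∀ u : H ⊗[k] H, D.compatMap (comul.lTensor H u) (D.coact m) =
      T ((TensorProduct.assoc k H H H).symm (comul.lTensor H u)) := by
    intro u
    induction u with
    | zero => simp
    | add u v hu hv => simp only [map_add, LinearMap.add_apply, hu, hv]
    | tmul a b =>
      rw [LinearMap.lTensor_tmul, compatMap_tmul_left, hD]
      generalize comul (R := k) b = v
      induction v with
      | zero => simp
      | add u v hu hv => simp only [map_add, LinearMap.add_apply, hu, hv, TensorProduct.tmul_add]
      | tmul b c => simp [T, mulCoeff_mulCoeff]
  have h2 : ∀ u : H ⊗[k] H, T (comul.rTensor H u) =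
      D.coact (D.act (TensorProduct.lid k H (counit.rTensor H u)) m) := by
    intro u
    induction u with
    | zero => simp
    | add u v hu hv => simp only [map_add, LinearMap.add_apply, hu, hv]
    | tmul a b =>
      simp [T, right_mul_antipodeInv_left, AlgHomClass.commutes, mulCoeff_algebraMap]
  rw [h1, Coalgebra.coassoc_symm_apply, h2]
  simp

theorem IsYD.isCrossed {D : YDDatum.{u, v, w} k H} (hD : D.IsYD) : D.IsCrossed :=
  D.isCrossed_of_compat hD.compat

/-! ### The unit object, conjugates and tensor products -/

variable (k H) in
theorem isYD_unit : (unit k H).IsYD where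
  one_act m := by simp
  mul_act h l m := by simp [mul_assoc]
  coassoc m := by simp [Algebra.TensorProduct.one_def]
  counit m := by simp
  compat := IsCrossed.compat (D := unit k H) fun h m => by
    have h1 : ∀ u : H ⊗[k] H, (unit k H).actMul u (m ⊗ₜ 1) =
        m ⊗ₜ[k] TensorProduct.lid k H (Coalgebra.counit.rTensor H u) := by
      intro u
      induction u with
      | zero => simp
      | add u v hu hv => simp only [map_add, LinearMap.add_apply, hu, hv, TensorProduct.tmul_add]
      | tmul a b =>
        change (counit (R := k) a * m) ⊗ₜ[k] (b * 1) = _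
        simp [TensorProduct.tmul_smul, TensorProduct.smul_tmul']
    have h2 : ∀ u : H ⊗[k] H, (unit k H).coactMul u m =
        m ⊗ₜ[k] TensorProduct.rid k H (Coalgebra.counit.lTensor H u) := by
      intro u
      induction u with
      | zero => simp
      | add u v hu hv => simp only [map_add, LinearMap.add_apply, hu, hv, TensorProduct.tmul_add]
      | tmul a b =>
        change (counit (R := k) b * m) ⊗ₜ[k] (1 * a) = _
        simp [TensorProduct.tmul_smul, TensorProduct.smul_tmul']
    change (unit k H).actMul (comul h) (m ⊗ₜ 1) = _
    rw [h1, h2]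
    simp

theorem IsYD.twist {D : YDDatum.{u, v, w} k H} (hD : D.IsYD) (g : AutPair k H) :
    (D.twist g).IsYD where
  one_act m := by simp [hD.one_act]
  mul_act h l m := by simp [hD.mul_act]
  coassoc m := by
    have h1 := congrArg (TensorProduct.map (autLin (g.fst * g.snd⁻¹))
      (autLin (g.fst * g.snd⁻¹)) |>.lTensor D.carrier) (hD.coassoc m)
    have h2 : ∀ t : D.carrier ⊗[k] H,
        TensorProduct.assoc k D.carrier H H ((D.twist g).coact.rTensor H
          ((autLin (g.fst * g.snd⁻¹)).lTensor D.carrier t)) =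
        (TensorProduct.map (autLin (g.fst * g.snd⁻¹)) (autLin (g.fst * g.snd⁻¹))).lTensor D.carrier
          (TensorProduct.assoc k D.carrier H H (D.coact.rTensor H t)) := by
      intro t
      induction t with
      | zero => simp
      | add s t hs ht => simp only [map_add, hs, ht]
      | tmul m x =>
        simp only [LinearMap.rTensor_tmul, LinearMap.lTensor_tmul, LinearMap.comp_apply]
        generalize D.coact m = s
        induction s with
        | zero => simp
        | add s t hs ht => simp only [map_add, hs, ht, TensorProduct.add_tmul]
        | tmul m y => simp
    have h3 : ∀ t : D.carrier ⊗[k] H,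
        (comul (R := k) (A := H)).lTensor D.carrier
          ((autLin (g.fst * g.snd⁻¹)).lTensor D.carrier t) =
        (TensorProduct.map (autLin (g.fst * g.snd⁻¹)) (autLin (g.fst * g.snd⁻¹))).lTensor D.carrier
          (comul.lTensor D.carrier t) := by
      intro t
      induction t with
      | zero => simp
      | add s t hs ht => simp only [map_add, hs, ht]
      | tmul m x => simp only [LinearMap.lTensor_tmul, autLin_apply, comul_aut]
    simp only [LinearMap.comp_apply] at h2 h3 ⊢
    rw [h2, h3, h1]
  counit m := by
    rw [← hD.counit m]
    simp only [LinearMap.comp_apply, ← LinearMap.lTensor_comp_apply]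
    congr 2
    ext x
    simp
  compat := IsCrossed.compat (D := D.twist g) fun h m => by
    have key := hD.isCrossed ((D.deg.fst⁻¹ * g.snd * D.deg.fst * g.fst⁻¹) h) m
    rw [comul_aut] at key
    have h1 : ∀ (u : H ⊗[k] H) (t : D.carrier ⊗[k] H), (D.twist g).actMul u
        ((autLin (g.fst * g.snd⁻¹)).lTensor D.carrier t) =
        (autLin (g.fst * g.snd⁻¹)).lTensor D.carrier (D.actMul (TensorProduct.map
          (autLin (D.deg.fst⁻¹ * g.snd * D.deg.fst * g.fst⁻¹))
          (autLin (D.deg.fst⁻¹ * g.snd * D.deg.fst * g.fst⁻¹)) u) t) := by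
      intro u t
      induction u with
      | zero => simp
      | add u v hu hv => simp only [map_add, LinearMap.add_apply, hu, hv]
      | tmul a b =>
        induction t with
        | zero => simp
        | add s t hs ht => simp only [map_add, hs, ht]
        | tmul m x => simp
    have h2 : ∀ u : H ⊗[k] H, (D.twist g).coactMul u m =
        (autLin (g.fst * g.snd⁻¹)).lTensor D.carrier (D.coactMul (TensorProduct.map
          (autLin (D.deg.fst⁻¹ * g.snd * D.deg.fst * g.fst⁻¹))
          (autLin (D.deg.fst⁻¹ * g.snd * D.deg.fst * g.fst⁻¹)) u) m) := by
      intro u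
      induction u with
      | zero => simp
      | add u v hu hv => simp only [map_add, LinearMap.add_apply, hu, hv]
      | tmul a b =>
        simp only [coactMul_tmul, TensorProduct.map_tmul, LinearMap.comp_apply, autLin_apply]
        generalize D.coact _ = t
        induction t with
        | zero => simp
        | add s t hs ht => simp only [map_add, hs, ht]
        | tmul m x => simp
    exact (h1 _ _).trans ((congrArg _ key).trans (h2 _).symm)

end compat

/-- For an algebra `A`, the map `(m ⊗ x, n ⊗ y) ↦ (m ⊗ n) ⊗ y x` which combines coactions. -/
def coactProd (k : Type u) [Field k] (A : Type*) [Ring A] [Algebra k A] (M : Type w₁) (N : Type w₂)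
    [AddCommGroup M] [Module k M] [AddCommGroup N] [Module k N] :
    M ⊗[k] A →ₗ[k] N ⊗[k] A →ₗ[k] (M ⊗[k] N) ⊗[k] A :=
  TensorProduct.curry ((LinearMap.mul' k A ∘ₗ (TensorProduct.comm k A A).toLinearMap).lTensor
    (M ⊗[k] N) ∘ₗ (TensorProduct.tensorTensorTensorComm k M A N A).toLinearMap)

section coactProd

variable {A B : Type*} [Ring A] [Algebra k A] [Ring B] [Algebra k B] {M : Type w₁} {N : Type w₂}
  [AddCommGroup M] [Module k M] [AddCommGroup N] [Module k N]

@[simp]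
theorem coactProd_tmul (m : M) (n : N) (x y : A) :
    coactProd k A M N (m ⊗ₜ x) (n ⊗ₜ y) = (m ⊗ₜ n) ⊗ₜ (y * x) := rfl

theorem lTensor_coactProd (f : A →ₐ[k] B) (s : M ⊗[k] A) (t : N ⊗[k] A) :
    f.toLinearMap.lTensor (M ⊗[k] N) (coactProd k A M N s t) =
      coactProd k B M N (f.toLinearMap.lTensor M s) (f.toLinearMap.lTensor N t) := by
  induction s with
  | zero => simp
  | add s t hs ht => simp only [map_add, LinearMap.add_apply, hs, ht]
  | tmul m x =>
    induction t with
    | zero => simp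
    | add s t hs ht => simp only [map_add, hs, ht]
    | tmul n y => simp

theorem coactProd_mulCoeff_left (x : H) (s : M ⊗[k] H) (t : N ⊗[k] H) :
    coactProd k H M N (mulCoeff k H M x s) t =
      mulCoeff k H (M ⊗[k] N) x (coactProd k H M N s t) := by
  induction s with
  | zero => simp
  | add s t hs ht => simp only [map_add, LinearMap.add_apply, hs, ht]
  | tmul m x =>
    induction t with
    | zero => simp
    | add s t hs ht => simp only [map_add, hs, ht]
    | tmul n y => simp [mul_assoc]

end coactProd

theorem tensor_coact_tmul (D : YDDatum.{u, v, w₁} k H) (E : YDDatum.{u, v, w₂} k H)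
    (m : D.carrier) (n : E.carrier) : (D.tensor E).coact (m ⊗ₜ n) =
      coactProd k H D.carrier E.carrier (D.coact m) (E.coact n) := rfl

/-- `a ⊗ b ↦ (m ⊗ n ↦ γ(a) · m ⊗ γ⁻¹βγ(b) · n)`; the action on a tensor product is its composition
with the comultiplication. -/
def tensorAct (D : YDDatum.{u, v, w₁} k H) (E : YDDatum.{u, v, w₂} k H) :
    H ⊗[k] H →ₗ[k] D.carrier ⊗[k] E.carrier →ₗ[k] D.carrier ⊗[k] E.carrier :=
  TensorProduct.homTensorHomMap (.id k) D.carrier E.carrier D.carrier E.carrier ∘ₗ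
    TensorProduct.map (D.act ∘ₗ autLin E.deg.fst)
      (E.act ∘ₗ autLin (E.deg.fst⁻¹ * D.deg.snd * E.deg.fst))

@[simp]
theorem tensorAct_tmul (D : YDDatum.{u, v, w₁} k H) (E : YDDatum.{u, v, w₂} k H) (a b : H)
    (m : D.carrier) (n : E.carrier) : D.tensorAct E (a ⊗ₜ b) (m ⊗ₜ n) =
      D.act (E.deg.fst a) m ⊗ₜ E.act (E.deg.fst⁻¹ (D.deg.snd (E.deg.fst b))) n := rfl

theorem tensor_act (D : YDDatum.{u, v, w₁} k H) (E : YDDatum.{u, v, w₂} k H) (h : H) :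
    (D.tensor E).act h = D.tensorAct E (comul h) := rfl

/-- Moving `h` past the coactions of `n` and then of `m` with the crossed condition, in
`γ(h₁) · m₀ ⊗ γ⁻¹βγ(h₂) · n₀ ⊗ δγ⁻¹βγ(h₃) n₁ m₁`. -/
theorem IsCrossed.tensor {D : YDDatum.{u, v, w₁} k H} {E : YDDatum.{u, v, w₂} k H}
    (hD : D.IsCrossed) (hE : E.IsCrossed) : (D.tensor E).IsCrossed := by
  intro h (t : D.carrier ⊗[k] E.carrier)
  induction t with
  | zero => simp
  | add s t hs ht => simp only [map_add, hs, ht]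
  | tmul m n =>
    let γ := E.deg.fst
    let σ := E.deg.fst⁻¹ * D.deg.snd * E.deg.fst
    let Ψ := coactProd k H D.carrier E.carrier
    let P : H →ₗ[k] D.carrier ⊗[k] H :=
      (LinearMap.rTensorHom H ∘ₗ D.act ∘ₗ autLin γ).flip (D.coact m)
    -- `W` is `a ⊗ b ⊗ c ↦ (γ(a) · m₀ ⊗ σ(b) · n₀) ⊗ δσ(c) n₁ m₁`; the crossed condition of `N`
    -- turns it into `V`, where `σ(c)` acts on `n` before the coaction, and that of `M` turns `V`
    -- into `U`, where `γ(b)` acts on `m` before the coaction.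
    let W : H ⊗[k] (H ⊗[k] H) →ₗ[k] (D.carrier ⊗[k] E.carrier) ⊗[k] H :=
      TensorProduct.lift (Ψ.compl₁₂ P
        ((E.actMul ∘ₗ TensorProduct.map (autLin σ) (autLin σ)).flip (E.coact n)))
    let V : H ⊗[k] (H ⊗[k] H) →ₗ[k] (D.carrier ⊗[k] E.carrier) ⊗[k] H :=
      TensorProduct.lift (Ψ.compl₁₂ P
        ((E.coactMul ∘ₗ TensorProduct.map (autLin σ) (autLin σ)).flip n))
    let U : (H ⊗[k] H) ⊗[k] H →ₗ[k] (D.carrier ⊗[k] E.carrier) ⊗[k] H :=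
      TensorProduct.lift (Ψ.compl₁₂ ((D.coactMul ∘ₗ TensorProduct.map (autLin γ) (autLin γ)).flip m)
        (E.coact ∘ₗ (E.act ∘ₗ autLin σ).flip n))
    have h1 : ∀ u : H ⊗[k] H, (D.tensor E).actMul u (Ψ (D.coact m) (E.coact n)) =
        W (TensorProduct.assoc k H H H (comul.rTensor H u)) := by
      intro u
      induction u with
      | zero => simp
      | add u v hu hv => simp only [map_add, LinearMap.add_apply, hu, hv]
      | tmul a c =>
        rw [LinearMap.rTensor_tmul]
        change TensorProduct.homTensorHomMap (.id k) _ H _ H (D.tensorAct E (comul a) ⊗ₜ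
          LinearMap.mul k H (E.deg.snd (σ c))) (Ψ (D.coact m) (E.coact n)) = _
        generalize comul (R := k) a = w
        induction w with
        | zero => simp
        | add u v hu hv =>
          simp only [map_add, LinearMap.add_apply, hu, hv, TensorProduct.add_tmul]
        | tmul a b =>
          simp only [TensorProduct.assoc_tmul, W, P, TensorProduct.lift.tmul,
            LinearMap.compl₁₂_apply, LinearMap.flip_apply, LinearMap.comp_apply,
            TensorProduct.map_tmul, autLin_apply]
          generalize D.coact m = s
          generalize E.coact n = t
          induction s with
          | zero => simp
          | add s t hs ht => simp only [map_add, LinearMap.add_apply, hs, ht]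
          | tmul m x =>
            induction t with
            | zero => simp
            | add s t hs ht => simp only [map_add, hs, ht]
            | tmul n y => simp [Ψ, σ, γ, mul_assoc]
    have h2 : ∀ u : H ⊗[k] H, W (comul.lTensor H u) = V (comul.lTensor H u) := by
      intro u
      induction u with
      | zero => simp
      | add u v hu hv => simp only [map_add, hu, hv]
      | tmul a b => simp [W, V, hE (σ b) n]
    have h3 : ∀ u : H ⊗[k] H, V (TensorProduct.assoc k H H H (comul.rTensor H u)) =
        U (comul.rTensor H u) := by
      intro u
      induction u with
      | zero => simp
      | add u v hu hv => simp only [map_add, hu, hv]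
      | tmul a c =>
        have h4 : ∀ u : H ⊗[k] H, V (TensorProduct.assoc k H H H (u ⊗ₜ c)) =
            Ψ (D.actMul (TensorProduct.map (autLin γ) (autLin γ) u) (D.coact m))
              (E.coact (E.act (σ c) n)) := by
          intro u
          induction u with
          | zero => simp
          | add u v hu hv =>
            simp only [map_add, LinearMap.add_apply, hu, hv, TensorProduct.add_tmul]
          | tmul a b =>
            simp only [TensorProduct.assoc_tmul, V, P, TensorProduct.lift.tmul,
              LinearMap.compl₁₂_apply, LinearMap.flip_apply, LinearMap.comp_apply,
              TensorProduct.map_tmul, autLin_apply, coactMul_tmul]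
            generalize D.coact m = s
            generalize E.coact _ = t
            induction s with
            | zero => simp
            | add s t hs ht => simp only [map_add, LinearMap.add_apply, hs, ht]
            | tmul m x =>
              induction t with
              | zero => simp
              | add s t hs ht => simp only [map_add, hs, ht]
              | tmul n y => simp [Ψ, σ, γ, mul_assoc]
        rw [LinearMap.rTensor_tmul, h4, ← comul_aut, hD]
        simp [U]
    have h5 : ∀ u : H ⊗[k] H, (D.tensor E).coactMul u (m ⊗ₜ n) =
        U ((TensorProduct.assoc k H H H).symm (comul.lTensor H u)) := by
      intro u
      induction u with
      | zero => simp
      | add u v hu hv => simp only [map_add, LinearMap.add_apply, hu, hv]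
      | tmul a b =>
        rw [coactMul_tmul, tensor_act, LinearMap.lTensor_tmul]
        generalize comul (R := k) b = u
        induction u with
        | zero => simp
        | add u v hu hv =>
          simp only [map_add, LinearMap.add_apply, hu, hv, TensorProduct.tmul_add]
        | tmul b c =>
          rw [tensorAct_tmul, tensor_coact_tmul, ← coactProd_mulCoeff_left]
          rfl
    rw [tensor_coact_tmul, h1, coassoc_apply, h2, ← coassoc_apply, h3, h5, coassoc_symm_apply]

theorem IsYD.tensor [Fact (Function.Bijective (HopfAlgebra.antipode k (A := H)))]
    {D : YDDatum.{u, v, w₁} k H} {E : YDDatum.{u, v, w₂} k H}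
    (hD : D.IsYD) (hE : E.IsYD) : (D.tensor E).IsYD where
  one_act (t : D.carrier ⊗[k] E.carrier) := by
    rw [tensor_act, Bialgebra.comul_one]
    induction t with
    | zero => simp
    | add s t hs ht => simp only [map_add, hs, ht]
    | tmul m n => simp [Algebra.TensorProduct.one_def, hD.one_act, hE.one_act]
  mul_act h l (t : D.carrier ⊗[k] E.carrier) := by
    change D.tensorAct E (comul (h * l)) t = D.tensorAct E (comul h) (D.tensorAct E (comul l) t)
    rw [Bialgebra.comul_mul]
    generalize comul (R := k) h = a
    generalize comul (R := k) l = b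
    induction t with
    | zero => simp
    | add s t hs ht => simp only [map_add, hs, ht]
    | tmul m n =>
      induction a with
      | zero => simp
      | add s t hs ht => simp only [map_add, add_mul, LinearMap.add_apply, hs, ht]
      | tmul a a' =>
        induction b with
        | zero => simp
        | add s t hs ht => simp only [map_add, mul_add, LinearMap.add_apply, hs, ht]
        | tmul b b' => simp [hD.mul_act, hE.mul_act]
  coassoc (t : D.carrier ⊗[k] E.carrier) := by
    have h1 : ∀ (s : D.carrier ⊗[k] H) (t : E.carrier ⊗[k] H),
        TensorProduct.assoc k _ H H ((D.tensor E).coact.rTensor H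
          (coactProd k H D.carrier E.carrier s t)) =
        coactProd k (H ⊗[k] H) D.carrier E.carrier
          (TensorProduct.assoc k _ H H (D.coact.rTensor H s))
          (TensorProduct.assoc k _ H H (E.coact.rTensor H t)) := by
      intro s t
      induction s with
      | zero => simp
      | add s t hs ht => simp only [map_add, LinearMap.add_apply, hs, ht]
      | tmul m x =>
        induction t with
        | zero => simp
        | add s t hs ht => simp only [map_add, hs, ht]
        | tmul n y =>
          rw [coactProd_tmul, LinearMap.rTensor_tmul, LinearMap.rTensor_tmul,
            LinearMap.rTensor_tmul, tensor_coact_tmul]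
          generalize D.coact m = s
          generalize E.coact n = t
          induction s with
          | zero => simp
          | add s t hs ht =>
            simp only [map_add, LinearMap.add_apply, TensorProduct.add_tmul, hs, ht]
          | tmul m x =>
            induction t with
            | zero => simp
            | add s t hs ht => simp only [map_add, TensorProduct.add_tmul, hs, ht]
            | tmul n y => simp
    induction t with
    | zero => simp
    | add s t hs ht => simp only [map_add, hs, ht]
    | tmul m n =>
      rw [tensor_coact_tmul, h1, hD.coassoc, hE.coassoc]
      exact (lTensor_coactProd (Bialgebra.comulAlgHom k H) _ _).symm
  counit (t : D.carrier ⊗[k] E.carrier) := by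
    induction t with
    | zero => simp
    | add s t hs ht => simp only [map_add, TensorProduct.add_tmul, hs, ht]
    | tmul m n =>
      rw [tensor_coact_tmul]
      refine (lTensor_coactProd (Bialgebra.counitAlgHom k H) _ _).trans ?_
      refine (congrArg₂ (fun s t => coactProd k k D.carrier E.carrier s t)
        (hD.counit m) (hE.counit n)).trans ?_
      simp
  compat := (hD.isCrossed.tensor hE.isCrossed).compat

end YDDatum

namespace YDDatum

open Coalgebra

variable {k : Type u} {H : Type v} [Field k] [Ring H] [HopfAlgebra k H]

/-! ### Dual objects -/

/-- `m ⊗ x ↦ f(m) x`. -/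
def pairLeft {M : Type w} [AddCommGroup M] [Module k M] (f : Module.Dual k M) (A : Type*)
    [AddCommGroup A] [Module k A] : M ⊗[k] A →ₗ[k] A :=
  (TensorProduct.lid k A).toLinearMap ∘ₗ f.rTensor A

@[simp]
theorem pairLeft_tmul {M : Type w} [AddCommGroup M] [Module k M] (f : Module.Dual k M)
    {A : Type*} [AddCommGroup A] [Module k A] (m : M) (x : A) :
    pairLeft f A (m ⊗ₜ x) = f m • x := rfl

theorem pairLeft_lTensor {M : Type w} [AddCommGroup M] [Module k M] (f : Module.Dual k M)
    {A B : Type*} [AddCommGroup A] [Module k A] [AddCommGroup B] [Module k B] (φ : A →ₗ[k] B)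
    (t : M ⊗[k] A) : pairLeft f B (φ.lTensor M t) = φ (pairLeft f A t) := by
  induction t with
  | zero => simp
  | add s t hs ht => simp only [map_add, hs, ht]
  | tmul m x => simp

theorem dualTensorHom_lTensor {M : Type w} [AddCommGroup M] [Module k M]
    {A B : Type*} [AddCommGroup A] [Module k A] [AddCommGroup B] [Module k B] (φ : A →ₗ[k] B)
    (t : Module.Dual k M ⊗[k] A) (m : M) :
    dualTensorHom k M B (φ.lTensor _ t) m = φ (dualTensorHom k M A t m) := by
  induction t with
  | zero => simp
  | add s t hs ht => simp only [map_add, LinearMap.add_apply, hs, ht]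
  | tmul m x => simp

/-- Elements of `M^* ⊗ A` are determined by the maps `M → A` they define. -/
theorem dual_tmul_ext {M : Type w} [AddCommGroup M] [Module k M] [Module.Finite k M] {A : Type*}
    [AddCommGroup A] [Module k A] {s t : Module.Dual k M ⊗[k] A}
    (h : ∀ m, dualTensorHom k M A s m = dualTensorHom k M A t m) : s = t :=
  dualTensorHom_bijective.injective (LinearMap.ext h)

/-- The dual space with `(h · f)(m) = f(β⁻¹α⁻¹T'(h) · m)`, `f₀(m) ⊗ f₁ = f(m₀) ⊗ T(m₁)`; the left
dual is the case `(T, T') = (S⁻¹, S)`, the right dual the case `(T, T') = (S, S⁻¹)`. -/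
@[reducible]
def dual (D : YDDatum.{u, v, w} k H) [Module.Finite k D.carrier] (T T' : H →ₗ[k] H) :
    YDDatum.{u, v, max u w} k H where
  carrier := Module.Dual k D.carrier
  deg := ⟨D.deg.fst⁻¹, D.deg.fst * D.deg.snd⁻¹ * D.deg.fst⁻¹⟩
  act := Module.Dual.transpose (R := k) ∘ₗ D.act ∘ₗ autLin (D.deg.snd⁻¹ * D.deg.fst⁻¹) ∘ₗ T'
  coact := D.dualCoact T

section

variable (D : YDDatum.{u, v, w} k H) [Module.Finite k D.carrier] (T T' : H →ₗ[k] H)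

theorem dual_act_apply (h : H) (f : Module.Dual k D.carrier) (m : D.carrier) :
    (D.dual T T').act h f m = f (D.act (D.deg.snd⁻¹ (D.deg.fst⁻¹ (T' h))) m) := rfl

theorem dualCoact_eval (f : Module.Dual k D.carrier) (m : D.carrier) :
    dualTensorHom k D.carrier H (D.dualCoact T f) m = T (pairLeft f H (D.coact m)) :=
  D.dualCoact_apply T f m

variable {T T'}

/-- Evaluated at `m`, both sides are `T(m₂) ⊗ T(m₁)` with coefficient `f(m₀)`. -/
theorem _root_.IsAntiPair.dual_coassoc [Fact (Function.Bijective (HopfAlgebra.antipode k (A := H)))]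
    (hT : IsAntiPair T T') (hD : D.IsYD) (f : Module.Dual k D.carrier) :
    TensorProduct.assoc k _ H H ((D.dualCoact T).rTensor H (D.dualCoact T f)) =
      (comul (R := k) (A := H)).lTensor _ (D.dualCoact T f) := by
  refine dual_tmul_ext fun m => ?_
  rw [dualTensorHom_lTensor, dualCoact_eval, hT.comul, ← pairLeft_lTensor, ← hD.coassoc]
  have h1 : ∀ t : Module.Dual k D.carrier ⊗[k] H,
      dualTensorHom k D.carrier (H ⊗[k] H)
        (TensorProduct.assoc k _ H H ((D.dualCoact T).rTensor H t)) m =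
      T.rTensor H (TensorProduct.comm k H H
        ((dualTensorHom k D.carrier H t).rTensor H (D.coact m))) := by
    intro t
    induction t with
    | zero => simp
    | add s t hs ht =>
      simp only [map_add, LinearMap.add_apply, LinearMap.rTensor_add, hs, ht]
    | tmul f x =>
      have h2 : ∀ c : Module.Dual k D.carrier ⊗[k] H,
          dualTensorHom k D.carrier (H ⊗[k] H) (TensorProduct.assoc k _ H H (c ⊗ₜ x)) m =
            dualTensorHom k D.carrier H c m ⊗ₜ x := by
        intro c
        induction c with
        | zero => simp
        | add s t hs ht =>
          simp only [map_add, LinearMap.add_apply, TensorProduct.add_tmul, hs, ht]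
        | tmul f y => simp [TensorProduct.smul_tmul']
      rw [LinearMap.rTensor_tmul, h2, dualCoact_eval]
      generalize D.coact m = s
      induction s with
      | zero => simp
      | add s t hs ht => simp only [map_add, TensorProduct.add_tmul, hs, ht]
      | tmul m y => simp [TensorProduct.tmul_smul, TensorProduct.smul_tmul']
  rw [h1]
  generalize D.coact m = s
  induction s with
  | zero => simp
  | add s t hs ht => simp only [map_add, hs, ht]
  | tmul m y =>
    have h3 : ∀ c : D.carrier ⊗[k] H, pairLeft f (H ⊗[k] H)
        (TensorProduct.assoc k D.carrier H H (c ⊗ₜ y)) = pairLeft f H c ⊗ₜ y := by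
      intro c
      induction c with
      | zero => simp
      | add s t hs ht => simp only [map_add, TensorProduct.add_tmul, hs, ht]
      | tmul m x => simp [TensorProduct.smul_tmul']
    rw [LinearMap.rTensor_tmul, LinearMap.rTensor_tmul, h3, dualCoact_eval]
    simp

/-- The crossed condition of the dual at `(h, f)`, evaluated at `m`, is the crossed condition of
`M` at `(β⁻¹α⁻¹T'(h), m)` with the two sides exchanged, paired with `f` and mapped by `T`. -/
theorem _root_.IsAntiPair.dual_isCrossed (hT : IsAntiPair T T') (hD : D.IsCrossed) :
    (D.dual T T').IsCrossed := by
  intro h f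
  refine dual_tmul_ext fun m => ?_
  let θ := D.deg.snd⁻¹ * D.deg.fst⁻¹
  let Θ : H ⊗[k] H →ₗ[k] H ⊗[k] H :=
    TensorProduct.map (autLin θ) (autLin θ) ∘ₗ TensorProduct.map T' T' ∘ₗ
      (TensorProduct.comm k H H).toLinearMap
  have key : D.actMul (Θ (comul h)) (D.coact m) = D.coactMul (Θ (comul h)) m := by
    have := hD (θ (T' h)) m
    rwa [comul_aut, hT.comul'] at this
  have h1 : ∀ u : H ⊗[k] H,
      dualTensorHom k D.carrier H ((D.dual T T').actMul u (D.dualCoact T f)) m =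
        T (pairLeft f H (D.coactMul (Θ u) m)) := by
    intro u
    induction u with
    | zero => simp
    | add u v hu hv => simp only [map_add, LinearMap.add_apply, hu, hv]
    | tmul a b =>
      have h2 : ∀ t : Module.Dual k D.carrier ⊗[k] H,
          dualTensorHom k D.carrier H ((D.dual T T').actMul (a ⊗ₜ b) t) m =
            (D.deg.fst * D.deg.snd⁻¹ * D.deg.fst⁻¹) b *
              dualTensorHom k D.carrier H t (D.act (θ (T' a)) m) := by
        intro t
        induction t with
        | zero => simp
        | add s t hs ht => simp only [map_add, LinearMap.add_apply, mul_add, hs, ht]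
        | tmul f x =>
          rw [actMul_tmul, dualTensorHom_apply, dualTensorHom_apply, mul_smul_comm]
          rfl
      rw [h2, dualCoact_eval]
      simp only [Θ, LinearMap.comp_apply, LinearEquiv.coe_coe, TensorProduct.comm_tmul,
        TensorProduct.map_tmul, autLin_apply, coactMul_tmul]
      generalize D.coact (D.act _ m) = s
      induction s with
      | zero => simp
      | add s t hs ht => simp only [map_add, mul_add, hs, ht]
      | tmul m x => simp [θ, hT.mul, hT.aut', hT.left_inv]
  have h3 : ∀ u : H ⊗[k] H,
      dualTensorHom k D.carrier H ((D.dual T T').coactMul u f) m =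
        T (pairLeft f H (D.actMul (Θ u) (D.coact m))) := by
    intro u
    induction u with
    | zero => simp
    | add u v hu hv => simp only [map_add, LinearMap.add_apply, hu, hv]
    | tmul a b =>
      have h4 : ∀ t : Module.Dual k D.carrier ⊗[k] H,
          dualTensorHom k D.carrier H (mulCoeff k H _ (D.deg.fst⁻¹ a) t) m =
            dualTensorHom k D.carrier H t m * D.deg.fst⁻¹ a := by
        intro t
        induction t with
        | zero => simp
        | add s t hs ht => simp only [map_add, LinearMap.add_apply, add_mul, hs, ht]
        | tmul f x => simp
      rw [coactMul_tmul, h4, dualCoact_eval]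
      generalize D.coact m = s
      induction s with
      | zero => simp
      | add s t hs ht => simp only [map_add, add_mul, hs, ht]
      | tmul m x =>
        simp only [Θ, LinearMap.comp_apply, LinearEquiv.coe_coe, TensorProduct.comm_tmul,
          TensorProduct.map_tmul, autLin_apply, actMul_tmul, pairLeft_tmul]
        simp [θ, hT.mul, hT.aut', hT.left_inv, Module.Dual.transpose_apply]
  exact (h1 _).trans ((congrArg (fun t => T (pairLeft f H t)) key.symm).trans (h3 _).symm)

theorem _root_.IsAntiPair.isYD_dual [Fact (Function.Bijective (HopfAlgebra.antipode k (A := H)))]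
    (hT : IsAntiPair T T') (hD : D.IsYD) : (D.dual T T').IsYD where
  one_act f := LinearMap.ext fun m => by
    rw [dual_act_apply, hT.one', map_one, map_one, hD.one_act]
  mul_act h l f := LinearMap.ext fun m => by
    rw [dual_act_apply, dual_act_apply, dual_act_apply, hT.mul', map_mul, map_mul, hD.mul_act]
  coassoc f := hT.dual_coassoc D hD f
  counit f := by
    refine dual_tmul_ext fun m => ?_
    rw [dualTensorHom_lTensor, dualCoact_eval, hT.counit, ← pairLeft_lTensor, hD.counit]
    simp
  compat := (hT.dual_isCrossed D hD.isCrossed).compat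

end

theorem IsYD.leftDual [Fact (Function.Bijective (HopfAlgebra.antipode k (A := H)))]
    {D : YDDatum.{u, v, w} k H} [Module.Finite k D.carrier] (hD : D.IsYD) : D.leftDual.IsYD :=
  isAntiPair_antipodeInv.isYD_dual D hD

theorem IsYD.rightDual [Fact (Function.Bijective (HopfAlgebra.antipode k (A := H)))]
    {D : YDDatum.{u, v, w} k H} [Module.Finite k D.carrier] (hD : D.IsYD) : D.rightDual.IsYD :=
  isAntiPair_antipode.isYD_dual D hD

end YDDatum

namespace YDDatum

open Coalgebra

variable {k : Type u} {H : Type v} [Field k] [Ring H] [HopfAlgebra k H]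

/-! ### Evaluation and coevaluation -/

/-- Under `M^* ⊗ M ≃ End(M)`, the coevaluation is `c ↦ c • id`. -/
theorem dualTensorHom_comm_coevaluation (M : Type w) [AddCommGroup M] [Module k M]
    [Module.Finite k M] (c : k) (m : M) :
    dualTensorHom k M M (TensorProduct.comm k M (Module.Dual k M) (coevaluation k M c)) m =
      c • m := by
  have h1 : coevaluation k M c = c • coevaluation k M 1 := by
    rw [← map_smul, smul_eq_mul, mul_one]
  rw [h1, coevaluation_apply_one]
  simp only [map_smul, map_sum, TensorProduct.comm_tmul, LinearMap.smul_apply,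
    LinearMap.sum_apply, dualTensorHom_apply, Module.Basis.coord_apply, Module.Basis.sum_repr]

section zigzag

variable (D : YDDatum.{u, v, w} k H) [Module.Finite k D.carrier]

/-- Contracting `z ⊗ m` over the inner factors is evaluation at `m` of the endomorphism given by
`z`, and the coevaluation gives the identity. -/
theorem leftZigzag (m : D.carrier) :
    TensorProduct.rid k D.carrier (D.leftEv.lTensor D.carrier
      (TensorProduct.assoc k D.carrier (Module.Dual k D.carrier) D.carrier
        (D.leftCoev.rTensor D.carrier ((1 : k) ⊗ₜ[k] m)))) = m := by
  have h1 : ∀ z : D.carrier ⊗[k] Module.Dual k D.carrier,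
      TensorProduct.rid k D.carrier (D.leftEv.lTensor D.carrier
        (TensorProduct.assoc k D.carrier (Module.Dual k D.carrier) D.carrier (z ⊗ₜ m))) =
      dualTensorHom k D.carrier D.carrier (TensorProduct.comm k _ _ z) m := by
    intro z
    induction z with
    | zero => simp
    | add s t hs ht => simp only [map_add, LinearMap.add_apply, TensorProduct.add_tmul, hs, ht]
    | tmul m f => simp [leftEv]
  rw [LinearMap.rTensor_tmul, h1, leftCoev, dualTensorHom_comm_coevaluation, one_smul]

theorem leftZigzag_dual (f : Module.Dual k D.carrier) :
    TensorProduct.lid k (Module.Dual k D.carrier) (D.leftEv.rTensor (Module.Dual k D.carrier)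
      ((TensorProduct.assoc k (Module.Dual k D.carrier) D.carrier (Module.Dual k D.carrier)).symm
        (D.leftCoev.lTensor (Module.Dual k D.carrier) (f ⊗ₜ[k] (1 : k))))) = f := by
  ext m
  have h1 : ∀ z : D.carrier ⊗[k] Module.Dual k D.carrier,
      TensorProduct.lid k (Module.Dual k D.carrier) (D.leftEv.rTensor (Module.Dual k D.carrier)
        ((TensorProduct.assoc k (Module.Dual k D.carrier) D.carrier
          (Module.Dual k D.carrier)).symm (f ⊗ₜ z))) m =
      f (dualTensorHom k D.carrier D.carrier (TensorProduct.comm k _ _ z) m) := by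
    intro z
    induction z with
    | zero => simp
    | add s t hs ht => simp only [map_add, LinearMap.add_apply, TensorProduct.tmul_add, hs, ht]
    | tmul m f => simp [leftEv, mul_comm]
  rw [LinearMap.lTensor_tmul, h1, leftCoev, dualTensorHom_comm_coevaluation, one_smul]

theorem rightZigzag (m : D.carrier) :
    TensorProduct.lid k D.carrier (D.rightEv.rTensor D.carrier
      ((TensorProduct.assoc k D.carrier (Module.Dual k D.carrier) D.carrier).symm
        (D.rightCoev.lTensor D.carrier (m ⊗ₜ[k] (1 : k))))) = m := by
  have h1 : ∀ z : Module.Dual k D.carrier ⊗[k] D.carrier,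
      TensorProduct.lid k D.carrier (D.rightEv.rTensor D.carrier
        ((TensorProduct.assoc k D.carrier (Module.Dual k D.carrier) D.carrier).symm (m ⊗ₜ z))) =
      dualTensorHom k D.carrier D.carrier z m := by
    intro z
    induction z with
    | zero => simp
    | add s t hs ht => simp only [map_add, LinearMap.add_apply, TensorProduct.tmul_add, hs, ht]
    | tmul f m => simp [rightEv]
  rw [LinearMap.lTensor_tmul, h1]
  exact (dualTensorHom_comm_coevaluation D.carrier 1 m).trans (one_smul k m)

theorem rightZigzag_dual (f : Module.Dual k D.carrier) :
    TensorProduct.rid k (Module.Dual k D.carrier) (D.rightEv.lTensor (Module.Dual k D.carrier)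
      (TensorProduct.assoc k (Module.Dual k D.carrier) D.carrier (Module.Dual k D.carrier)
        (D.rightCoev.rTensor (Module.Dual k D.carrier) ((1 : k) ⊗ₜ[k] f)))) = f := by
  ext m
  have h1 : ∀ z : Module.Dual k D.carrier ⊗[k] D.carrier,
      TensorProduct.rid k (Module.Dual k D.carrier) (D.rightEv.lTensor (Module.Dual k D.carrier)
        (TensorProduct.assoc k (Module.Dual k D.carrier) D.carrier (Module.Dual k D.carrier)
          (z ⊗ₜ f))) m =
      f (dualTensorHom k D.carrier D.carrier z m) := by
    intro z
    induction z with
    | zero => simp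
    | add s t hs ht => simp only [map_add, LinearMap.add_apply, TensorProduct.add_tmul, hs, ht]
    | tmul f m => simp [rightEv, mul_comm]
  rw [LinearMap.rTensor_tmul, h1]
  exact congrArg f ((dualTensorHom_comm_coevaluation D.carrier 1 m).trans (one_smul k m))

end zigzag

variable [Fact (Function.Bijective (HopfAlgebra.antipode k (A := H)))]

/-- If `Φ(x₁ ⊗ x₂) = ε(x)` for all `x`, then `m₀ ⊗ Φ(m₁ ⊗ m₂) = m ⊗ 1`. -/
theorem IsYD.collapse {D : YDDatum.{u, v, w} k H} (hD : D.IsYD) (Φ : H ⊗[k] H →ₗ[k] H)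
    (hΦ : ∀ x : H, Φ (comul x) = algebraMap k H (Coalgebra.counit x)) (m : D.carrier) :
    Φ.lTensor D.carrier (TensorProduct.assoc k D.carrier H H (D.coact.rTensor H (D.coact m))) =
      m ⊗ₜ 1 := by
  have h1 : Φ ∘ₗ comul = Algebra.linearMap k H ∘ₗ Coalgebra.counit := LinearMap.ext hΦ
  rw [hD.coassoc, ← LinearMap.lTensor_comp_apply, h1, LinearMap.lTensor_comp_apply, hD.counit]
  simp

section ev

variable {D : YDDatum.{u, v, w} k H} [Module.Finite k D.carrier]

/-- Linearity comes from `f(β⁻¹(S(h₁) h₂) · m)`, colinearity from `f(m₀) m₂ S⁻¹(m₁)`. -/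
theorem IsYD.isMor_leftEv (hD : D.IsYD) :
    IsMor (D.leftDual.tensor D) (unit k H) D.leftEv where
  deg_eq := inv_mul_cancel D.deg
  map_act h (z : Module.Dual k D.carrier ⊗[k] D.carrier) := by
    induction z with
    | zero => simp
    | add s t hs ht => simp only [map_add, hs, ht]
    | tmul f m =>
      have h1 : ∀ u : H ⊗[k] H, D.leftEv (D.leftDual.tensorAct D u (f ⊗ₜ m)) =
          f (D.act (D.deg.snd⁻¹ (LinearMap.mul' k H
            ((HopfAlgebra.antipode k).rTensor H u))) m) := by
        intro u
        induction u with
        | zero => simp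
        | add u v hu hv => simp only [map_add, LinearMap.add_apply, hu, hv]
        | tmul a b =>
          change f (D.act (D.deg.snd⁻¹ (D.deg.fst⁻¹ (HopfAlgebra.antipode k (D.deg.fst a))))
            (D.act (D.deg.fst⁻¹ (D.deg.fst (D.deg.snd⁻¹ (D.deg.fst⁻¹ (D.deg.fst b))))) m)) = _
          simp only [LinearMap.rTensor_tmul, LinearMap.mul'_apply, map_mul, hD.mul_act,
            aut_antipode, bialgAut_inv_apply_self]
      refine (h1 (comul h)).trans ?_
      rw [HopfAlgebra.mul_antipode_rTensor_comul_apply, AlgHomClass.commutes,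
        Algebra.algebraMap_eq_smul_one, map_smul, LinearMap.smul_apply, hD.one_act, map_smul]
      rfl
  map_coact (z : Module.Dual k D.carrier ⊗[k] D.carrier) := by
    induction z with
    | zero => simp
    | add s t hs ht => simp only [map_add, hs, ht]
    | tmul f m =>
      have h1 : ∀ (t : Module.Dual k D.carrier ⊗[k] H) (s : D.carrier ⊗[k] H),
          D.leftEv.rTensor H (coactProd k H _ _ t s) = 1 ⊗ₜ LinearMap.mul' k H
            (TensorProduct.comm k H H ((dualTensorHom k D.carrier H t).rTensor H s)) := by
        intro t s
        induction t with
        | zero => simp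
        | add t t' ht ht' =>
          simp only [map_add, LinearMap.add_apply, LinearMap.rTensor_add, ht, ht',
            TensorProduct.tmul_add]
        | tmul f x =>
          induction s with
          | zero => simp
          | add s t hs ht => simp only [map_add, hs, ht, TensorProduct.tmul_add]
          | tmul m y => simp [leftEv, TensorProduct.smul_tmul']
      have h2 : ∀ s : D.carrier ⊗[k] H, LinearMap.mul' k H (TensorProduct.comm k H H
          ((dualTensorHom k D.carrier H (D.leftDual.coact f)).rTensor H s)) =
          pairLeft f H ((LinearMap.mul' k H ∘ₗ (antipodeInv k H).lTensor H ∘ₗ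
            (TensorProduct.comm k H H).toLinearMap).lTensor D.carrier
            (TensorProduct.assoc k D.carrier H H (D.coact.rTensor H s))) := by
        intro s
        induction s with
        | zero => simp
        | add s t hs ht => simp only [map_add, hs, ht]
        | tmul m y =>
          rw [LinearMap.rTensor_tmul, dualCoact_eval, LinearMap.rTensor_tmul]
          generalize D.coact m = s
          induction s with
          | zero => simp
          | add s t hs ht => simp only [map_add, TensorProduct.add_tmul, hs, ht]
          | tmul m x => simp
      rw [tensor_coact_tmul, h1, h2, hD.collapse _ right_mul_antipodeInv_left]
      change f m ⊗ₜ[k] (1 : H) = _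
      rw [pairLeft_tmul, TensorProduct.tmul_smul, TensorProduct.smul_tmul', smul_eq_mul, mul_one]

/-- Linearity comes from `f(α⁻¹(S⁻¹(h₂) h₁) · m)`, colinearity from `f(m₀) S(m₁) m₂`. -/
theorem IsYD.isMor_rightEv (hD : D.IsYD) :
    IsMor (D.tensor D.rightDual) (unit k H) D.rightEv where
  deg_eq := mul_inv_cancel D.deg
  map_act h (z : D.carrier ⊗[k] Module.Dual k D.carrier) := by
    induction z with
    | zero => simp
    | add s t hs ht => simp only [map_add, hs, ht]
    | tmul m f =>
      have h1 : ∀ u : H ⊗[k] H, D.rightEv (D.tensorAct D.rightDual u (m ⊗ₜ f)) =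
          f (D.act (D.deg.fst⁻¹ (LinearMap.mul' k H
            ((antipodeInv k H).rTensor H (TensorProduct.comm k H H u)))) m) := by
        intro u
        induction u with
        | zero => simp
        | add u v hu hv => simp only [map_add, LinearMap.add_apply, hu, hv]
        | tmul a b =>
          change f (D.act (D.deg.snd⁻¹ (D.deg.fst⁻¹ (antipodeInv k H
            (D.deg.fst (D.deg.snd (D.deg.fst⁻¹ b)))))) (D.act (D.deg.fst⁻¹ a) m)) = _
          simp only [TensorProduct.comm_tmul, LinearMap.rTensor_tmul, LinearMap.mul'_apply, map_mul,
            hD.mul_act, aut_antipodeInv, bialgAut_inv_apply_self]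
      refine (h1 (comul h)).trans ?_
      rw [antipodeInv_right_mul_left, AlgHomClass.commutes,
        Algebra.algebraMap_eq_smul_one, map_smul, LinearMap.smul_apply, hD.one_act, map_smul]
      rfl
  map_coact (z : D.carrier ⊗[k] Module.Dual k D.carrier) := by
    induction z with
    | zero => simp
    | add s t hs ht => simp only [map_add, hs, ht]
    | tmul m f =>
      have h1 : ∀ (t : Module.Dual k D.carrier ⊗[k] H) (s : D.carrier ⊗[k] H),
          D.rightEv.rTensor H (coactProd k H _ _ s t) = 1 ⊗ₜ LinearMap.mul' k H
            ((dualTensorHom k D.carrier H t).rTensor H s) := by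
        intro t s
        induction t with
        | zero => simp
        | add t t' ht ht' =>
          simp only [map_add, LinearMap.add_apply, LinearMap.rTensor_add, ht, ht',
            TensorProduct.tmul_add]
        | tmul f x =>
          induction s with
          | zero => simp
          | add s t hs ht =>
            simp only [map_add, LinearMap.add_apply, hs, ht, TensorProduct.tmul_add]
          | tmul m y => simp [rightEv, TensorProduct.smul_tmul']
      have h2 : ∀ s : D.carrier ⊗[k] H, LinearMap.mul' k H
          ((dualTensorHom k D.carrier H (D.rightDual.coact f)).rTensor H s) =
          pairLeft f H ((LinearMap.mul' k H ∘ₗ (HopfAlgebra.antipode k).rTensor H).lTensor D.carrier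
            (TensorProduct.assoc k D.carrier H H (D.coact.rTensor H s))) := by
        intro s
        induction s with
        | zero => simp
        | add s t hs ht => simp only [map_add, hs, ht]
        | tmul m y =>
          rw [LinearMap.rTensor_tmul, dualCoact_eval, LinearMap.rTensor_tmul]
          generalize D.coact m = s
          induction s with
          | zero => simp
          | add s t hs ht => simp only [map_add, TensorProduct.add_tmul, hs, ht]
          | tmul m x => simp
      rw [tensor_coact_tmul, h1, h2,
        hD.collapse _ HopfAlgebra.mul_antipode_rTensor_comul_apply]
      change f m ⊗ₜ[k] (1 : H) = _
      rw [pairLeft_tmul, TensorProduct.tmul_smul, TensorProduct.smul_tmul', smul_eq_mul, mul_one]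

/-- With `M ⊗ M^*` seen as `End(M)`, where the coevaluation is `c ↦ c • id`, linearity comes from
`α⁻¹(h₁ S(h₂)) · m` and colinearity from `m₀ ⊗ S⁻¹(m₂) m₁`. -/
theorem IsYD.isMor_leftCoev (hD : D.IsYD) :
    IsMor (unit k H) (D.tensor D.leftDual) D.leftCoev where
  deg_eq := (mul_inv_cancel D.deg).symm
  map_act h c := by
    have h1 : ∀ (a b : H) (z : D.carrier ⊗[k] Module.Dual k D.carrier) (m : D.carrier),
        dualTensorHom k D.carrier D.carrier (TensorProduct.comm k D.carrier _
          (D.tensorAct D.leftDual (a ⊗ₜ b) z)) m =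
        D.act (D.deg.fst⁻¹ a) (dualTensorHom k D.carrier D.carrier
          (TensorProduct.comm k D.carrier _ z)
            (D.act (D.deg.fst⁻¹ (HopfAlgebra.antipode k b)) m)) := by
      intro a b z m
      induction z with
      | zero => simp
      | add s t hs ht => simp only [map_add, hs, LinearMap.add_apply, ht]
      | tmul n f =>
        change f (D.act (D.deg.snd⁻¹ (D.deg.fst⁻¹ (HopfAlgebra.antipode k
          (D.deg.fst (D.deg.snd (D.deg.fst⁻¹ b)))))) m) • D.act (D.deg.fst⁻¹ a) n = _
        simp [aut_antipode]
    have h2 : ∀ (u : H ⊗[k] H) (m : D.carrier),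
        dualTensorHom k D.carrier D.carrier (TensorProduct.comm k D.carrier _
          (D.tensorAct D.leftDual u (D.leftCoev c))) m =
        c • D.act (D.deg.fst⁻¹ (LinearMap.mul' k H ((HopfAlgebra.antipode k).lTensor H u))) m := by
      intro u m
      induction u with
      | zero => simp
      | add u v hu hv => simp only [map_add, LinearMap.add_apply, smul_add, hu, hv]
      | tmul a b =>
        rw [h1, leftCoev, dualTensorHom_comm_coevaluation, map_smul, ← hD.mul_act]
        simp
    apply (TensorProduct.comm k D.carrier (Module.Dual k D.carrier)).injective
    refine dual_tmul_ext fun m => ?_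
    refine Eq.trans ?_ (h2 (comul h) m).symm
    rw [HopfAlgebra.mul_antipode_lTensor_comul_apply, AlgHomClass.commutes,
      Algebra.algebraMap_eq_smul_one, map_smul, LinearMap.smul_apply, hD.one_act, leftCoev,
      dualTensorHom_comm_coevaluation, smul_smul, mul_comm]
    rfl
  map_coact c := by
    apply ((TensorProduct.comm k D.carrier (Module.Dual k D.carrier)).rTensor H ≪≫ₗ
      TensorProduct.assoc k (Module.Dual k D.carrier) D.carrier H).injective
    refine dual_tmul_ext fun m => ?_
    have h1 : ∀ (s : D.carrier ⊗[k] H) (t : Module.Dual k D.carrier ⊗[k] H),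
        dualTensorHom k D.carrier (D.carrier ⊗[k] H) (TensorProduct.assoc k _ _ H
          ((TensorProduct.comm k D.carrier (Module.Dual k D.carrier)).rTensor H
            (coactProd k H _ _ s t))) m =
        (LinearMap.mulLeft k (dualTensorHom k D.carrier H t m)).lTensor D.carrier s := by
      intro s t
      induction t with
      | zero => simp
      | add t t' ht ht' =>
        have : ∀ x y : H, LinearMap.mulLeft k (x + y) = LinearMap.mulLeft k x +
          LinearMap.mulLeft k y := (LinearMap.mul k H).map_add
        simp only [map_add, LinearMap.add_apply, this, LinearMap.lTensor_add, ht, ht']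
      | tmul f x =>
        induction s with
        | zero => simp
        | add s t hs ht => simp only [map_add, LinearMap.add_apply, hs, ht]
        | tmul n y => simp
    have h2 : ∀ z : D.carrier ⊗[k] Module.Dual k D.carrier,
        dualTensorHom k D.carrier (D.carrier ⊗[k] H) (TensorProduct.assoc k _ _ H
          ((TensorProduct.comm k D.carrier (Module.Dual k D.carrier)).rTensor H
            ((D.tensor D.leftDual).coact z))) m =
        (LinearMap.mul' k H ∘ₗ (antipodeInv k H).rTensor H ∘ₗ
          (TensorProduct.comm k H H).toLinearMap).lTensor D.carrier
          (TensorProduct.assoc k D.carrier H H (D.coact.rTensor H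
            ((dualTensorHom k D.carrier D.carrier (TensorProduct.comm k _ _ z)).rTensor H
              (D.coact m)))) := by
      intro z
      induction z with
      | zero => simp
      | add s t hs ht => simp only [map_add, LinearMap.add_apply, LinearMap.rTensor_add, hs, ht]
      | tmul n f =>
        rw [tensor_coact_tmul, h1, dualCoact_eval]
        generalize D.coact m = s
        induction s with
        | zero => simp
        | add s t hs ht =>
          have : ∀ x y : H, LinearMap.mulLeft k (x + y) = LinearMap.mulLeft k x +
            LinearMap.mulLeft k y := (LinearMap.mul k H).map_add
          simp only [map_add, LinearMap.add_apply, this, LinearMap.lTensor_add, hs, ht]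
        | tmul m x =>
          simp only [TensorProduct.comm_tmul, LinearMap.rTensor_tmul, dualTensorHom_apply,
            map_smul, pairLeft_tmul]
          generalize D.coact n = t
          induction t with
          | zero => simp
          | add s t hs ht => simp only [map_add, TensorProduct.add_tmul, smul_add, hs, ht]
          | tmul n y => simp [TensorProduct.smul_tmul']
    have h3 : dualTensorHom k D.carrier D.carrier (TensorProduct.comm k _ _ (D.leftCoev c)) =
        c • LinearMap.id := LinearMap.ext fun m => dualTensorHom_comm_coevaluation _ c m
    refine (h2 (D.leftCoev c)).trans ?_
    rw [h3, LinearMap.rTensor_smul, LinearMap.rTensor_id, LinearMap.smul_apply,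
      LinearMap.id_apply, map_smul, map_smul, map_smul, hD.collapse _ antipodeInv_right_mul_left]
    have h4 : ∀ z : D.carrier ⊗[k] Module.Dual k D.carrier,
        dualTensorHom k D.carrier (D.carrier ⊗[k] H) (TensorProduct.assoc k _ _ H
          ((TensorProduct.comm k D.carrier (Module.Dual k D.carrier)).rTensor H (z ⊗ₜ 1))) m =
        dualTensorHom k D.carrier D.carrier (TensorProduct.comm k _ _ z) m ⊗ₜ 1 := by
      intro z
      induction z with
      | zero => simp
      | add s t hs ht => simp only [map_add, LinearMap.add_apply, TensorProduct.add_tmul, hs, ht]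
      | tmul n f => simp [TensorProduct.smul_tmul']
    refine Eq.trans ?_ (h4 (D.leftCoev c)).symm
    rw [h3, LinearMap.smul_apply, LinearMap.id_apply, TensorProduct.smul_tmul']

/-- With `M^* ⊗ M` seen as `End(M)`, where the coevaluation is `c ↦ c • id`, linearity comes from
`β⁻¹(h₂ S⁻¹(h₁)) · m` and colinearity from `m₀ ⊗ m₁ S(m₂)`. -/
theorem IsYD.isMor_rightCoev (hD : D.IsYD) :
    IsMor (unit k H) (D.rightDual.tensor D) D.rightCoev where
  deg_eq := (inv_mul_cancel D.deg).symm
  map_act h c := by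
    have h1 : ∀ (a b : H) (z : Module.Dual k D.carrier ⊗[k] D.carrier) (m : D.carrier),
        dualTensorHom k D.carrier D.carrier (D.rightDual.tensorAct D (a ⊗ₜ b) z) m =
        D.act (D.deg.snd⁻¹ b) (dualTensorHom k D.carrier D.carrier z
            (D.act (D.deg.snd⁻¹ (antipodeInv k H a)) m)) := by
      intro a b z m
      induction z with
      | zero => simp
      | add s t hs ht => simp only [map_add, hs, LinearMap.add_apply, ht]
      | tmul f n =>
        change f (D.act (D.deg.snd⁻¹ (D.deg.fst⁻¹ (antipodeInv k H (D.deg.fst a)))) m) •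
          D.act (D.deg.fst⁻¹ (D.deg.fst (D.deg.snd⁻¹ (D.deg.fst⁻¹ (D.deg.fst b))))) n = _
        simp [aut_antipodeInv]
    have h2 : ∀ (u : H ⊗[k] H) (m : D.carrier),
        dualTensorHom k D.carrier D.carrier (D.rightDual.tensorAct D u (D.rightCoev c)) m =
        c • D.act (D.deg.snd⁻¹ (LinearMap.mul' k H ((antipodeInv k H).lTensor H
          (TensorProduct.comm k H H u)))) m := by
      intro u m
      induction u with
      | zero => simp
      | add u v hu hv => simp only [map_add, LinearMap.add_apply, smul_add, hu, hv]
      | tmul a b =>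
        refine (h1 a b _ m).trans ((congrArg (D.act (D.deg.snd⁻¹ b))
          (dualTensorHom_comm_coevaluation D.carrier c _)).trans ?_)
        rw [map_smul, ← hD.mul_act]
        simp
    refine dual_tmul_ext fun m => ?_
    refine Eq.trans ?_ (h2 (comul h) m).symm
    rw [right_mul_antipodeInv_left, AlgHomClass.commutes,
      Algebra.algebraMap_eq_smul_one, map_smul, LinearMap.smul_apply, hD.one_act]
    refine (dualTensorHom_comm_coevaluation D.carrier _ m).trans ?_
    rw [smul_smul, mul_comm]
    rfl
  map_coact c := by
    apply (TensorProduct.assoc k (Module.Dual k D.carrier) D.carrier H).injective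
    refine dual_tmul_ext fun m => ?_
    have h1 : ∀ (s : D.carrier ⊗[k] H) (t : Module.Dual k D.carrier ⊗[k] H),
        dualTensorHom k D.carrier (D.carrier ⊗[k] H) (TensorProduct.assoc k _ _ H
            (coactProd k H _ _ t s)) m =
        mulCoeff k H D.carrier (dualTensorHom k D.carrier H t m) s := by
      intro s t
      induction t with
      | zero => simp
      | add t t' ht ht' => simp only [map_add, LinearMap.add_apply, ht, ht']
      | tmul f x =>
        induction s with
        | zero => simp
        | add s t hs ht => simp only [map_add, LinearMap.add_apply, hs, ht]
        | tmul n y => simp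
    have h2 : ∀ z : Module.Dual k D.carrier ⊗[k] D.carrier,
        dualTensorHom k D.carrier (D.carrier ⊗[k] H) (TensorProduct.assoc k _ _ H
            ((D.rightDual.tensor D).coact z)) m =
        (LinearMap.mul' k H ∘ₗ (HopfAlgebra.antipode k).lTensor H).lTensor D.carrier
          (TensorProduct.assoc k D.carrier H H (D.coact.rTensor H
            ((dualTensorHom k D.carrier D.carrier z).rTensor H (D.coact m)))) := by
      intro z
      induction z with
      | zero => simp
      | add s t hs ht => simp only [map_add, LinearMap.add_apply, LinearMap.rTensor_add, hs, ht]
      | tmul f n =>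
        rw [tensor_coact_tmul, h1, dualCoact_eval]
        generalize D.coact m = s
        induction s with
        | zero => simp
        | add s t hs ht => simp only [map_add, LinearMap.add_apply, hs, ht]
        | tmul m x =>
          simp only [LinearMap.rTensor_tmul, dualTensorHom_apply, map_smul, pairLeft_tmul]
          generalize D.coact n = t
          induction t with
          | zero => simp
          | add s t hs ht => simp only [map_add, TensorProduct.add_tmul, smul_add, hs, ht]
          | tmul n y => simp [TensorProduct.smul_tmul']
    have h3 : dualTensorHom k D.carrier D.carrier (D.rightCoev c) =
        c • LinearMap.id := LinearMap.ext fun m => dualTensorHom_comm_coevaluation _ c m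
    refine (h2 (D.rightCoev c)).trans ?_
    rw [h3, LinearMap.rTensor_smul, LinearMap.rTensor_id, LinearMap.smul_apply,
      LinearMap.id_apply, map_smul, map_smul, map_smul,
      hD.collapse _ HopfAlgebra.mul_antipode_lTensor_comul_apply]
    have h4 : ∀ z : Module.Dual k D.carrier ⊗[k] D.carrier,
        dualTensorHom k D.carrier (D.carrier ⊗[k] H) (TensorProduct.assoc k _ _ H (z ⊗ₜ 1)) m =
        dualTensorHom k D.carrier D.carrier z m ⊗ₜ 1 := by
      intro z
      induction z with
      | zero => simp
      | add s t hs ht => simp only [map_add, LinearMap.add_apply, TensorProduct.add_tmul, hs, ht]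
      | tmul n f => simp [TensorProduct.smul_tmul']
    refine Eq.trans ?_ (h4 (D.rightCoev c)).symm
    rw [h3, LinearMap.smul_apply, LinearMap.id_apply, TensorProduct.smul_tmul']

end ev

end YDDatum

namespace YDDatum

open Coalgebra

variable {k : Type u} {H : Type v} [Field k] [Ring H] [HopfAlgebra k H]

/-! ### The monoidal structure on morphisms -/

theorem isMor_id (D : YDDatum.{u, v, w} k H) : D.IsMor D LinearMap.id :=
  ⟨rfl, fun _ _ => rfl, fun m => by simp⟩

theorem IsMor.symm {D : YDDatum.{u, v, w₁} k H} {E : YDDatum.{u, v, w₂} k H}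
    {e : D.carrier ≃ₗ[k] E.carrier} (he : IsMor D E e.toLinearMap) :
    IsMor E D e.symm.toLinearMap where
  deg_eq := he.deg_eq.symm
  map_act h m := by
    apply e.injective
    have := he.map_act h (e.symm m)
    simp only [LinearEquiv.coe_coe, LinearEquiv.apply_symm_apply] at this ⊢
    exact this.symm
  map_coact m := by
    have := he.map_coact (e.symm m)
    simp only [LinearEquiv.coe_coe, LinearEquiv.apply_symm_apply] at this ⊢
    rw [this, ← LinearMap.rTensor_comp_apply]
    simp

theorem IsMor.tensor {D D' E E' : YDDatum.{u, v, w} k H} {φ : D.carrier →ₗ[k] D'.carrier}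
    {ψ : E.carrier →ₗ[k] E'.carrier} (hφ : IsMor D D' φ) (hψ : IsMor E E' ψ) :
    IsMor (D.tensor E) (D'.tensor E') (TensorProduct.map φ ψ) where
  deg_eq := congrArg₂ (fun a b : AutPair k H => a * b) hφ.deg_eq hψ.deg_eq
  map_act h (t : D.carrier ⊗[k] E.carrier) := by
    rw [tensor_act, tensor_act]
    generalize comul (R := k) h = u
    induction u with
    | zero => simp
    | add u v hu hv => simp only [map_add, LinearMap.add_apply, hu, hv]
    | tmul a b =>
      induction t with
      | zero => simp
      | add s t hs ht => simp only [map_add, hs, ht]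
      | tmul m n =>
        simp only [tensorAct_tmul, TensorProduct.map_tmul, hφ.map_act, hψ.map_act, hφ.deg_eq,
          hψ.deg_eq]
  map_coact (t : D.carrier ⊗[k] E.carrier) := by
    induction t with
    | zero => simp
    | add s t hs ht => simp only [map_add, hs, ht]
    | tmul m n =>
      rw [TensorProduct.map_tmul, tensor_coact_tmul, tensor_coact_tmul, hφ.map_coact,
        hψ.map_coact]
      generalize D.coact m = s
      generalize E.coact n = t
      induction s with
      | zero => simp
      | add s t hs ht => simp only [map_add, LinearMap.add_apply, hs, ht]
      | tmul m x =>
        induction t with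
        | zero => simp
        | add s t hs ht => simp only [map_add, hs, ht]
        | tmul n y => simp

theorem IsMor.twist {D D' : YDDatum.{u, v, w} k H} {φ : D.carrier →ₗ[k] D'.carrier}
    (hφ : IsMor D D' φ) (g : AutPair k H) : IsMor (D.twist g) (D'.twist g) φ where
  deg_eq := congrArg (fun d : AutPair k H => (⟨g.fst * d.fst * g.fst⁻¹,
    g.fst * g.snd⁻¹ * d.snd * d.fst⁻¹ * g.snd * d.fst * g.fst⁻¹⟩ : AutPair k H)) hφ.deg_eq
  map_act h m := by
    simp only [LinearMap.comp_apply, hφ.map_act, hφ.deg_eq]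
  map_coact m := by
    simp only [LinearMap.comp_apply, hφ.map_coact]
    generalize D.coact m = s
    induction s with
    | zero => simp
    | add s t hs ht => simp only [map_add, hs, ht]
    | tmul m x => simp

theorem isMor_assoc (D E F : YDDatum.{u, v, w} k H) :
    IsMor ((D.tensor E).tensor F) (D.tensor (E.tensor F))
      (TensorProduct.assoc k D.carrier E.carrier F.carrier).toLinearMap where
  deg_eq := mul_assoc D.deg E.deg F.deg
  map_act h (z : (D.carrier ⊗[k] E.carrier) ⊗[k] F.carrier) := by
    induction z with
    | zero => simp
    | add s t hs ht => simp only [map_add, hs, ht]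
    | tmul z p =>
      induction z with
      | zero => simp
      | add s t hs ht => simp only [map_add, TensorProduct.add_tmul, hs, ht]
      | tmul m n =>
        -- the threefold action; both bracketings are `T` applied to `h₁ ⊗ h₂ ⊗ h₃`
        let T : H ⊗[k] (H ⊗[k] H) →ₗ[k] D.carrier ⊗[k] (E.carrier ⊗[k] F.carrier) :=
          TensorProduct.map ((D.act ∘ₗ autLin (E.deg.fst * F.deg.fst)).flip m)
            (TensorProduct.map
              ((E.act ∘ₗ autLin (E.deg.fst⁻¹ * D.deg.snd * E.deg.fst * F.deg.fst)).flip n)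
              ((F.act ∘ₗ autLin (F.deg.fst⁻¹ * E.deg.snd * E.deg.fst⁻¹ * D.deg.snd * E.deg.fst *
                F.deg.fst)).flip p))
        have h1 : ∀ u : H ⊗[k] H, TensorProduct.assoc k D.carrier E.carrier F.carrier
            ((D.tensor E).tensorAct F u ((m ⊗ₜ n) ⊗ₜ p)) =
            T (TensorProduct.assoc k H H H (comul.rTensor H u)) := by
          intro u
          induction u with
          | zero => simp
          | add u v hu hv => simp only [map_add, LinearMap.add_apply, hu, hv]
          | tmul a c =>
            rw [tensorAct_tmul, tensor_act, comul_aut, LinearMap.rTensor_tmul]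
            generalize comul (R := k) a = v
            induction v with
            | zero => simp
            | add u v hu hv =>
              simp only [map_add, LinearMap.add_apply, TensorProduct.add_tmul, hu, hv]
            | tmul a b => simp [T]
        have h2 : ∀ u : H ⊗[k] H, D.tensorAct (E.tensor F) u (m ⊗ₜ (n ⊗ₜ p)) =
            T (comul.lTensor H u) := by
          intro u
          induction u with
          | zero => simp
          | add u v hu hv => simp only [map_add, LinearMap.add_apply, hu, hv]
          | tmul a c =>
            rw [tensorAct_tmul, tensor_act, comul_aut, comul_aut, comul_aut, LinearMap.lTensor_tmul]
            generalize comul (R := k) c = v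
            induction v with
            | zero => simp
            | add u v hu hv =>
              simp only [map_add, LinearMap.add_apply, TensorProduct.tmul_add, hu, hv]
            | tmul b c => simp [T, mul_inv_rev]
        refine (h1 (comul h)).trans ?_
        rw [coassoc_apply, ← h2]
        rfl
  map_coact (z : (D.carrier ⊗[k] E.carrier) ⊗[k] F.carrier) := by
    induction z with
    | zero => simp
    | add s t hs ht => simp only [map_add, hs, ht]
    | tmul z p =>
      induction z with
      | zero => simp
      | add s t hs ht => simp only [map_add, TensorProduct.add_tmul, hs, ht]
      | tmul m n =>
        change coactProd k H _ _ (D.coact m) (coactProd k H _ _ (E.coact n) (F.coact p)) =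
          (TensorProduct.assoc k D.carrier E.carrier F.carrier).toLinearMap.rTensor H
            (coactProd k H _ _ (coactProd k H _ _ (D.coact m) (E.coact n)) (F.coact p))
        generalize D.coact m = s
        generalize E.coact n = t
        generalize F.coact p = r
        induction s with
        | zero => simp
        | add s t hs ht => simp only [map_add, LinearMap.add_apply, hs, ht]
        | tmul m x =>
          induction t with
          | zero => simp
          | add s t hs ht => simp only [map_add, LinearMap.add_apply, hs, ht]
          | tmul n y =>
            induction r with
            | zero => simp
            | add s t hs ht => simp only [map_add, hs, ht]
            | tmul p z => simp [mul_assoc]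

theorem isMor_lid (D : YDDatum.{u, v, u} k H) :
    IsMor ((unit k H).tensor D) D (TensorProduct.lid k D.carrier).toLinearMap where
  deg_eq := one_mul D.deg
  map_act h (z : k ⊗[k] D.carrier) := by
    induction z with
    | zero => simp
    | add s t hs ht => simp only [map_add, hs, ht]
    | tmul c m =>
      have h1 : ∀ u : H ⊗[k] H, TensorProduct.lid k D.carrier
          ((unit k H).tensorAct D u (c ⊗ₜ m)) =
          c • D.act (TensorProduct.lid k H (counit.rTensor H u)) m := by
        intro u
        induction u with
        | zero => simp
        | add u v hu hv => simp only [map_add, LinearMap.add_apply, smul_add, hu, hv]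
        | tmul a b =>
          change (counit (R := k) (D.deg.fst a) * c) • D.act (D.deg.fst⁻¹ (D.deg.fst b)) m = _
          simp [smul_smul, mul_comm]
      refine (h1 (comul h)).trans ?_
      simp
  map_coact (z : k ⊗[k] D.carrier) := by
    induction z with
    | zero => simp
    | add s t hs ht => simp only [map_add, hs, ht]
    | tmul c m =>
      change D.coact (c • m) = (TensorProduct.lid k D.carrier).toLinearMap.rTensor H
        (coactProd k H k _ (c ⊗ₜ 1) (D.coact m))
      rw [map_smul]
      generalize D.coact m = s
      induction s with
      | zero => simp
      | add s t hs ht => simp only [map_add, smul_add, hs, ht]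
      | tmul m x => simp [TensorProduct.smul_tmul']

theorem isMor_rid (D : YDDatum.{u, v, u} k H) :
    IsMor (D.tensor (unit k H)) D (TensorProduct.rid k D.carrier).toLinearMap where
  deg_eq := mul_one D.deg
  map_act h (z : D.carrier ⊗[k] k) := by
    induction z with
    | zero => simp
    | add s t hs ht => simp only [map_add, hs, ht]
    | tmul m c =>
      have h1 : ∀ u : H ⊗[k] H, TensorProduct.rid k D.carrier
          (D.tensorAct (unit k H) u (m ⊗ₜ c)) =
          c • D.act (TensorProduct.rid k H (counit.lTensor H u)) m := by
        intro u
        induction u with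
        | zero => simp
        | add u v hu hv => simp only [map_add, LinearMap.add_apply, smul_add, hu, hv]
        | tmul a b =>
          change (counit (R := k) (D.deg.snd b) * c) • D.act a m = _
          simp [smul_smul, mul_comm]
      refine (h1 (comul h)).trans ?_
      simp
  map_coact (z : D.carrier ⊗[k] k) := by
    induction z with
    | zero => simp
    | add s t hs ht => simp only [map_add, hs, ht]
    | tmul m c =>
      change D.coact (c • m) = (TensorProduct.rid k D.carrier).toLinearMap.rTensor H
        (coactProd k H _ k (D.coact m) (c ⊗ₜ 1))
      rw [map_smul]
      generalize D.coact m = s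
      induction s with
      | zero => simp
      | add s t hs ht => simp only [map_add, LinearMap.add_apply, smul_add, hs, ht]
      | tmul m x => simp [TensorProduct.smul_tmul']

/-! ### The braiding -/

/-- `n ⊗ m ↦ n₀ ⊗ ψ(n₁) · m`. -/
def coactAct (D : YDDatum.{u, v, w₁} k H) (E : YDDatum.{u, v, w₂} k H) (ψ : H →ₗ[k] H) :
    E.carrier ⊗[k] D.carrier →ₗ[k] E.carrier ⊗[k] D.carrier :=
  (TensorProduct.lift (D.act ∘ₗ ψ)).lTensor E.carrier ∘ₗ
    (TensorProduct.assoc k E.carrier H D.carrier).toLinearMap ∘ₗ E.coact.rTensor D.carrier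

theorem coactAct_tmul (D : YDDatum.{u, v, w₁} k H) (E : YDDatum.{u, v, w₂} k H) (ψ : H →ₗ[k] H)
    (m : D.carrier) (n : E.carrier) : D.coactAct E ψ (n ⊗ₜ m) =
      ((D.act ∘ₗ ψ).flip m).lTensor E.carrier (E.coact n) := by
  simp only [coactAct, LinearMap.comp_apply, LinearMap.rTensor_tmul]
  generalize E.coact n = t
  induction t with
  | zero => simp
  | add s t hs ht => simp only [map_add, TensorProduct.add_tmul, hs, ht]
  | tmul n x => simp

theorem braid_tmul (D : YDDatum.{u, v, w₁} k H) (E : YDDatum.{u, v, w₂} k H)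
    (m : D.carrier) (n : E.carrier) : D.braid E (m ⊗ₜ n) =
      ((D.act ∘ₗ autLin D.deg.snd⁻¹).flip m).lTensor E.carrier (E.coact n) :=
  D.coactAct_tmul E (autLin D.deg.snd⁻¹) m n

section

variable [Fact (Function.Bijective (HopfAlgebra.antipode k (A := H)))]

/-- If `ψ(x₁) φ(x₂) = ε(x)`, the maps `n ⊗ m ↦ n₀ ⊗ ψ(n₁) · m` and `n ⊗ m ↦ n₀ ⊗ φ(n₁) · m` compose
to the identity. -/
theorem coactAct_comp {D : YDDatum.{u, v, w₁} k H} {E : YDDatum.{u, v, w₂} k H} (hD : D.IsYD)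
    (hE : E.IsYD) (ψ φ : H →ₗ[k] H)
    (h : ∀ x, LinearMap.mul' k H (TensorProduct.map ψ φ (comul x)) =
      algebraMap k H (counit (R := k) x)) :
    D.coactAct E ψ ∘ₗ D.coactAct E φ = LinearMap.id := by
  refine TensorProduct.ext' fun n m => ?_
  have h1 : ∀ t : E.carrier ⊗[k] H,
      D.coactAct E ψ (((D.act ∘ₗ φ).flip m).lTensor E.carrier t) =
      (D.act.flip m).lTensor E.carrier ((LinearMap.mul' k H ∘ₗ TensorProduct.map ψ φ).lTensor
        E.carrier (TensorProduct.assoc k E.carrier H H (E.coact.rTensor H t))) := by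
    intro t
    induction t with
    | zero => simp
    | add s t hs ht => simp only [map_add, hs, ht]
    | tmul n x =>
      rw [LinearMap.lTensor_tmul, coactAct_tmul, LinearMap.rTensor_tmul]
      generalize E.coact n = t
      induction t with
      | zero => simp
      | add s t hs ht => simp only [map_add, TensorProduct.add_tmul, hs, ht]
      | tmul n y => simp [hD.mul_act]
  rw [LinearMap.comp_apply, coactAct_tmul, h1, hE.collapse _ h]
  simp [hD.one_act]

/-- The braiding is bijective, with inverse `n ⊗ m ↦ β⁻¹(S(n₁)) · m ⊗ n₀`. -/
def braidEquiv {D : YDDatum.{u, v, w₁} k H} {E : YDDatum.{u, v, w₂} k H} (hD : D.IsYD)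
    (hE : E.IsYD) : D.carrier ⊗[k] E.carrier ≃ₗ[k] E.carrier ⊗[k] D.carrier :=
  TensorProduct.comm k D.carrier E.carrier ≪≫ₗ
    LinearEquiv.ofLinearMap (D.coactAct E (autLin D.deg.snd⁻¹))
      (D.coactAct E (autLin D.deg.snd⁻¹ ∘ₗ HopfAlgebra.antipode k))
      (coactAct_comp hD hE _ _ fun x => by
        rw [← AlgHomClass.commutes (D.deg.snd⁻¹) (counit (R := k) x),
          ← HopfAlgebra.mul_antipode_lTensor_comul_apply]
        generalize comul (R := k) x = u
        induction u with
        | zero => simp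
        | add u v hu hv => simp only [map_add, hu, hv]
        | tmul a b => simp)
      (coactAct_comp hD hE _ _ fun x => by
        rw [← AlgHomClass.commutes (D.deg.snd⁻¹) (counit (R := k) x),
          ← HopfAlgebra.mul_antipode_rTensor_comul_apply]
        generalize comul (R := k) x = u
        induction u with
        | zero => simp
        | add u v hu hv => simp only [map_add, hu, hv]
        | tmul a b => simp)

/-- Linearity of the braiding is the crossed condition of `N`, and its colinearity is the crossed
condition of `M`. -/
theorem isMor_braid {D E : YDDatum.{u, v, w} k H} (hD : D.IsYD) (hE : E.IsYD) :
    IsMor (D.tensor E) ((E.twist D.deg).tensor D) (D.braid E) where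
  deg_eq := by
    have h1 : D.deg * E.deg = (D.deg * E.deg * D.deg⁻¹) * D.deg := by group
    refine h1.trans ?_
    refine congrArg (· * D.deg) (AutPair.ext rfl ?_)
    change D.deg.fst * D.deg.snd⁻¹ * D.deg.fst⁻¹ * D.deg.fst⁻¹⁻¹ *
      (E.deg.snd * E.deg.fst⁻¹ * D.deg.snd * E.deg.fst) * D.deg.fst⁻¹ =
      D.deg.fst * D.deg.snd⁻¹ * E.deg.snd * E.deg.fst⁻¹ * D.deg.snd * E.deg.fst * D.deg.fst⁻¹
    group
  map_act h (z : D.carrier ⊗[k] E.carrier) := by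
    induction z with
    | zero => simp
    | add s t hs ht => simp only [map_add, hs, ht]
    | tmul m n =>
      let σ := E.deg.fst⁻¹ * D.deg.snd * E.deg.fst
      let B := ((D.act ∘ₗ autLin D.deg.snd⁻¹).flip m).lTensor E.carrier
      have h1 : ∀ u : H ⊗[k] H, D.braid E (D.tensorAct E u (m ⊗ₜ n)) =
          B (E.coactMul (TensorProduct.map (autLin σ) (autLin σ) u) n) := by
        intro u
        induction u with
        | zero => simp
        | add u v hu hv => simp only [map_add, LinearMap.add_apply, hu, hv]
        | tmul a b =>
          rw [tensorAct_tmul, braid_tmul, TensorProduct.map_tmul, coactMul_tmul]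
          simp only [autLin_apply, σ, bialgAut_mul_apply]
          generalize E.coact _ = t
          induction t with
          | zero => simp
          | add s t hs ht => simp only [map_add, hs, ht]
          | tmul n x => simp [B, hD.mul_act]
      have h2 : ∀ (u : H ⊗[k] H) (t : E.carrier ⊗[k] H),
          (E.twist D.deg).tensorAct D u (B t) =
          B (E.actMul (TensorProduct.map (autLin σ) (autLin σ) u) t) := by
        intro u t
        induction u with
        | zero => simp
        | add u v hu hv => simp only [map_add, LinearMap.add_apply, hu, hv]
        | tmul a b =>
          induction t with
          | zero => simp
          | add s t hs ht => simp only [map_add, hs, ht]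
          | tmul n x => simp [B, σ, hD.mul_act]
      refine (h1 (comul h)).trans ?_
      rw [← comul_aut, ← hE.isCrossed (σ h) n, comul_aut, ← h2, braid_tmul]
      rfl
  map_coact (z : D.carrier ⊗[k] E.carrier) := by
    induction z with
    | zero => simp
    | add s t hs ht => simp only [map_add, hs, ht]
    | tmul m n =>
      let θ := autLin D.deg.snd⁻¹
      let T (f : H ⊗[k] H →ₗ[k] D.carrier ⊗[k] H) : E.carrier ⊗[k] (H ⊗[k] H) →ₗ[k]
          (E.carrier ⊗[k] D.carrier) ⊗[k] H :=
        (TensorProduct.assoc k E.carrier D.carrier H).symm.toLinearMap ∘ₗ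
          (f ∘ₗ TensorProduct.map θ θ).lTensor E.carrier
      have h1 : ∀ t : E.carrier ⊗[k] H, ((E.twist D.deg).tensor D).coact
          (((D.act ∘ₗ θ).flip m).lTensor E.carrier t) =
          T (D.coactMul.flip m) (TensorProduct.assoc k E.carrier H H (E.coact.rTensor H t)) := by
        intro t
        induction t with
        | zero => simp
        | add s t hs ht => simp only [map_add, hs, ht]
        | tmul n x =>
          rw [LinearMap.lTensor_tmul, tensor_coact_tmul, LinearMap.rTensor_tmul,
            LinearMap.comp_apply]
          generalize E.coact n = s
          induction s with
          | zero => simp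
          | add s t hs ht =>
            simp only [map_add, LinearMap.add_apply, TensorProduct.add_tmul, hs, ht]
          | tmul n y =>
            simp only [T, TensorProduct.assoc_tmul, LinearMap.comp_apply, LinearMap.lTensor_tmul,
              TensorProduct.map_tmul, LinearMap.flip_apply, coactMul_tmul]
            generalize D.coact _ = r
            induction r with
            | zero => simp
            | add s t hs ht => simp only [map_add, TensorProduct.tmul_add, hs, ht]
            | tmul m z => simp [θ]
      have h2 : ∀ t : E.carrier ⊗[k] H, T (D.coactMul.flip m) (comul.lTensor E.carrier t) =
          T (D.actMul.flip (D.coact m)) (comul.lTensor E.carrier t) := by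
        intro t
        induction t with
        | zero => simp
        | add s t hs ht => simp only [map_add, hs, ht]
        | tmul n x =>
          simp only [T, LinearMap.comp_apply, LinearMap.lTensor_tmul, θ, ← comul_aut,
            LinearMap.flip_apply, hD.isCrossed _ m]
      have h3 : ∀ (s : D.carrier ⊗[k] H) (t : E.carrier ⊗[k] H),
          (D.braid E).rTensor H (coactProd k H _ _ s t) =
          T (D.actMul.flip s) (TensorProduct.assoc k E.carrier H H (E.coact.rTensor H t)) := by
        intro s t
        induction t with
        | zero => simp
        | add s t hs ht => simp only [map_add, hs, ht]
        | tmul n x =>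
          induction s with
          | zero => simp [T]
          | add s t hs ht =>
            simp only [map_add, LinearMap.add_apply, hs, ht, T, LinearMap.add_comp,
              LinearMap.lTensor_add, LinearMap.comp_apply]
          | tmul m y =>
            rw [coactProd_tmul, LinearMap.rTensor_tmul, braid_tmul, LinearMap.rTensor_tmul]
            generalize E.coact n = r
            induction r with
            | zero => simp
            | add s t hs ht => simp only [map_add, TensorProduct.add_tmul, hs, ht]
            | tmul n z => simp [T, θ]
      rw [braid_tmul, h1, hE.coassoc, h2, ← hE.coassoc, ← h3]
      rfl

end

theorem braid_naturality {D D' E E' : YDDatum.{u, v, w} k H} {φ : D.carrier →ₗ[k] D'.carrier}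
    {ψ : E.carrier →ₗ[k] E'.carrier} (hφ : IsMor D D' φ) (hψ : IsMor E E' ψ)
    (z : D.carrier ⊗[k] E.carrier) :
    D'.braid E' (TensorProduct.map φ ψ z) = TensorProduct.map ψ φ (D.braid E z) := by
  induction z with
  | zero => simp
  | add s t hs ht => simp only [map_add, hs, ht]
  | tmul m n =>
    rw [TensorProduct.map_tmul, braid_tmul, braid_tmul, hψ.map_coact]
    generalize E.coact n = t
    induction t with
    | zero => simp
    | add s t hs ht => simp only [map_add, hs, ht]
    | tmul n x => simp [hφ.map_act, hφ.deg_eq]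

/-- The coassociativity of `P` turns the action of `h ↦ h₁ ⊗ h₂` on `M ⊗ N` by the coefficient of
`P` into two successive coactions. -/
theorem braid_tensor_left {D E F : YDDatum.{u, v, w} k H}
    [Fact (Function.Bijective (HopfAlgebra.antipode k (A := H)))] (hF : F.IsYD)
    (z : (D.carrier ⊗[k] E.carrier) ⊗[k] F.carrier) :
    (D.tensor E).braid F z =
      TensorProduct.assoc k F.carrier D.carrier E.carrier
        ((D.braid (F.twist E.deg)).rTensor E.carrier
          ((TensorProduct.assoc k D.carrier F.carrier E.carrier).symm
            ((E.braid F).lTensor D.carrier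
              (TensorProduct.assoc k D.carrier E.carrier F.carrier z)))) := by
  induction z with
  | zero => simp
  | add s t hs ht => simp only [map_add, hs, ht]
  | tmul z p =>
    induction z with
    | zero => simp
    | add s t hs ht => simp only [map_add, TensorProduct.add_tmul, hs, ht]
    | tmul m n =>
      let T : F.carrier ⊗[k] (H ⊗[k] H) →ₗ[k] F.carrier ⊗[k] (D.carrier ⊗[k] E.carrier) :=
        (TensorProduct.map
          ((D.act ∘ₗ autLin (D.deg.snd⁻¹ * E.deg.fst * E.deg.snd⁻¹)).flip m)
          ((E.act ∘ₗ autLin E.deg.snd⁻¹).flip n)).lTensor F.carrier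
      have h1 : ∀ t : F.carrier ⊗[k] H, TensorProduct.assoc k F.carrier D.carrier E.carrier
          ((D.braid (F.twist E.deg)).rTensor E.carrier
            ((TensorProduct.assoc k D.carrier F.carrier E.carrier).symm (m ⊗ₜ
              ((E.act ∘ₗ autLin E.deg.snd⁻¹).flip n).lTensor F.carrier t))) =
          T (TensorProduct.assoc k F.carrier H H (F.coact.rTensor H t)) := by
        intro t
        induction t with
        | zero => simp
        | add s t hs ht => simp only [map_add, TensorProduct.tmul_add, hs, ht]
        | tmul p x =>
          rw [LinearMap.lTensor_tmul, TensorProduct.assoc_symm_tmul, LinearMap.rTensor_tmul,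
            braid_tmul, LinearMap.rTensor_tmul, LinearMap.comp_apply]
          generalize F.coact p = s
          induction s with
          | zero => simp
          | add s t hs ht => simp only [map_add, TensorProduct.add_tmul, hs, ht]
          | tmul p y => simp [T]
      have h2 : ∀ t : F.carrier ⊗[k] H,
          (((D.tensor E).act ∘ₗ autLin (D.tensor E).deg.snd⁻¹).flip (m ⊗ₜ n)).lTensor
            F.carrier t = T (comul.lTensor F.carrier t) := by
        intro t
        induction t with
        | zero => simp
        | add s t hs ht => simp only [map_add, hs, ht]
        | tmul p x =>
          rw [LinearMap.lTensor_tmul, LinearMap.lTensor_tmul, LinearMap.flip_apply,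
            LinearMap.comp_apply, tensor_act, autLin_apply, comul_aut]
          generalize comul (R := k) x = u
          induction u with
          | zero => simp
          | add s t hs ht =>
            simp only [map_add, LinearMap.add_apply, TensorProduct.tmul_add, hs, ht]
          | tmul a b => simp [T, mul_inv_rev]
      rw [TensorProduct.assoc_tmul, LinearMap.lTensor_tmul, braid_tmul, braid_tmul, h1, h2,
        hF.coassoc]

/-- The coaction on `N ⊗ P` has the coefficient `p₁ n₁`, so it acts on `M` by `n₁` and then by
`p₁`. -/
theorem braid_tensor_right {D E F : YDDatum.{u, v, w} k H}
    [Fact (Function.Bijective (HopfAlgebra.antipode k (A := H)))] (hD : D.IsYD)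
    (z : D.carrier ⊗[k] (E.carrier ⊗[k] F.carrier)) :
    D.braid (E.tensor F) z =
      (TensorProduct.assoc k E.carrier F.carrier D.carrier).symm
        ((D.braid F).lTensor E.carrier
          (TensorProduct.assoc k E.carrier D.carrier F.carrier
            ((D.braid E).rTensor F.carrier
              ((TensorProduct.assoc k D.carrier E.carrier F.carrier).symm z)))) := by
  induction z with
  | zero => simp
  | add s t hs ht => simp only [map_add, hs, ht]
  | tmul m z =>
    induction z with
    | zero => simp
    | add s t hs ht => simp only [map_add, TensorProduct.tmul_add, hs, ht]
    | tmul n p =>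
      rw [TensorProduct.assoc_symm_tmul, LinearMap.rTensor_tmul, braid_tmul, braid_tmul,
        tensor_coact_tmul]
      generalize E.coact n = s
      induction s with
      | zero => simp
      | add s t hs ht =>
        simp only [map_add, LinearMap.add_apply, TensorProduct.add_tmul, hs, ht]
      | tmul n x =>
        rw [LinearMap.lTensor_tmul, TensorProduct.assoc_tmul, LinearMap.lTensor_tmul, braid_tmul]
        generalize F.coact p = t
        induction t with
        | zero => simp
        | add s t hs ht => simp only [map_add, TensorProduct.tmul_add, hs, ht]
        | tmul p y => simp [hD.mul_act]

end YDDatum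

namespace YDDatum

variable {k : Type u} {H : Type v} [Field k] [Ring H] [HopfAlgebra k H]

set_option maxRecDepth 1000 in
/-- The braiding is stable under conjugation: the twist of the action and the twist of the
coefficient cancel. -/
theorem braid_twist (D E : YDDatum.{u, v, w} k H) (g : AutPair k H)
    (z : D.carrier ⊗[k] E.carrier) :
    (D.twist g).braid (E.twist g) z = D.braid E z := by
  induction z with
  | zero => exact (map_zero _).trans (map_zero _).symm
  | add s t hs ht => exact (map_add _ s t).trans ((congrArg₂ _ hs ht).trans (map_add _ s t).symm)
  | tmul m n =>
    let θ := D.deg.fst⁻¹ * g.snd * D.deg.fst * g.fst⁻¹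
    let β' := g.fst * g.snd⁻¹ * D.deg.snd * D.deg.fst⁻¹ * g.snd * D.deg.fst * g.fst⁻¹
    have h : ∀ t : E.carrier ⊗[k] H,
        (((D.act ∘ₗ autLin θ) ∘ₗ autLin β'⁻¹).flip m).lTensor E.carrier
          ((autLin (g.fst * g.snd⁻¹)).lTensor E.carrier t) =
        ((D.act ∘ₗ autLin D.deg.snd⁻¹).flip m).lTensor E.carrier t := by
      intro t
      induction t with
      | zero => simp
      | add s t hs ht => simp only [map_add, hs, ht]
      | tmul n x => simp [θ, β', mul_inv_rev]
    have e1 : (D.twist g).braid (E.twist g) (m ⊗ₜ n) =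
        (((D.act ∘ₗ autLin θ) ∘ₗ autLin β'⁻¹).flip m).lTensor E.carrier
          ((autLin (g.fst * g.snd⁻¹)).lTensor E.carrier (E.coact n)) :=
      braid_tmul (D.twist g) (E.twist g) m n
    exact e1.trans ((h _).trans (D.braid_tmul E m n).symm)

end YDDatum

namespace YDDatum

variable {k : Type u} {H : Type v} [Field k] [Ring H] [HopfAlgebra k H]

/-! ### Strictness of the conjugation -/

/-- Data on the same space are equal when their structure maps agree pointwise. -/
theorem mk_congr {M : Type w} [AddCommGroup M] [Module k M] {d d' : AutPair k H}
    {a a' : H →ₗ[k] M →ₗ[k] M} {r r' : M →ₗ[k] M ⊗[k] H} (hd : d = d')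
    (ha : ∀ h m, a h m = a' h m) (hr : ∀ m, r m = r' m) :
    (⟨M, d, a, r⟩ : YDDatum.{u, v, w} k H) = ⟨M, d', a', r'⟩ := by
  obtain rfl := hd
  obtain rfl : a = a' := LinearMap.ext fun h => LinearMap.ext fun m => ha h m
  obtain rfl : r = r' := LinearMap.ext hr
  rfl

theorem twist_deg (D : YDDatum.{u, v, w} k H) (g : AutPair k H) :
    (D.twist g).deg = g * D.deg * g⁻¹ := by
  refine AutPair.ext rfl ?_
  change g.fst * g.snd⁻¹ * D.deg.snd * D.deg.fst⁻¹ * g.snd * D.deg.fst * g.fst⁻¹ =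
    g.fst * g.snd⁻¹ * g.fst⁻¹ * g.fst⁻¹⁻¹ * (D.deg.snd * D.deg.fst⁻¹ * g.snd * D.deg.fst) * g.fst⁻¹
  group

theorem twist_one (D : YDDatum.{u, v, w} k H) : D.twist 1 = D := by
  refine mk_congr (AutPair.ext ?_ ?_) (fun h m => ?_) fun m => ?_
  · change 1 * D.deg.fst * 1⁻¹ = D.deg.fst
    group
  · change 1 * 1⁻¹ * D.deg.snd * D.deg.fst⁻¹ * 1 * D.deg.fst * 1⁻¹ = D.deg.snd
    group
  · change D.act ((D.deg.fst⁻¹ * 1 * D.deg.fst * 1⁻¹) h) m = _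
    congr 2
    rw [show D.deg.fst⁻¹ * 1 * D.deg.fst * 1⁻¹ = 1 by group]
    rfl
  · change (autLin (1 * 1⁻¹)).lTensor D.carrier (D.coact m) = _
    rw [show (1 * 1⁻¹ : H ≃ₐc[k] H) = 1 by group]
    exact LinearMap.lTensor_id_apply _ _ _

theorem twist_mul (D : YDDatum.{u, v, w} k H) (g h : AutPair k H) :
    D.twist (g * h) = (D.twist h).twist g := by
  refine mk_congr ?_ (fun x m => ?_) fun m => ?_
  · refine (twist_deg D (g * h)).trans (Eq.trans ?_ (twist_deg (D.twist h) g).symm)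
    rw [twist_deg]
    group
  · change D.act ((D.deg.fst⁻¹ * (h.snd * h.fst⁻¹ * g.snd * h.fst) * D.deg.fst *
      (g.fst * h.fst)⁻¹) x) m = D.act ((D.deg.fst⁻¹ * h.snd * D.deg.fst * h.fst⁻¹)
        (((h.fst * D.deg.fst * h.fst⁻¹)⁻¹ * g.snd * (h.fst * D.deg.fst * h.fst⁻¹) * g.fst⁻¹) x)) m
    simp [mul_inv_rev]
  · change (autLin (g.fst * h.fst * (h.snd * h.fst⁻¹ * g.snd * h.fst)⁻¹)).lTensor D.carrier
      (D.coact m) = (autLin (g.fst * g.snd⁻¹)).lTensor D.carrier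
        ((autLin (h.fst * h.snd⁻¹)).lTensor D.carrier (D.coact m))
    rw [← LinearMap.lTensor_comp_apply]
    congr 2
    ext x
    simp [mul_inv_rev]

theorem twist_unit (g : AutPair k H) : (unit k H).twist g = unit k H := by
  refine mk_congr ?_ (fun x m => ?_) fun m => ?_
  · refine (twist_deg (unit k H) g).trans ?_
    change g * 1 * g⁻¹ = 1
    group
  · change Coalgebra.counit (R := k) _ * m = Coalgebra.counit (R := k) x * m
    rw [autLin_apply, counit_aut]
  · change (autLin (g.fst * g.snd⁻¹)).lTensor k (m ⊗ₜ 1) = m ⊗ₜ 1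
    rw [LinearMap.lTensor_tmul, autLin_apply, map_one]

theorem twist_tensor (D E : YDDatum.{u, v, w} k H) (g : AutPair k H) :
    (D.tensor E).twist g = (D.twist g).tensor (E.twist g) := by
  refine mk_congr ?_ (fun x (m : D.carrier ⊗[k] E.carrier) => ?_)
    fun (m : D.carrier ⊗[k] E.carrier) => ?_
  · refine (twist_deg (D.tensor E) g).trans ?_
    change g * (D.deg * E.deg) * g⁻¹ = (D.twist g).deg * (E.twist g).deg
    rw [twist_deg, twist_deg]
    group
  · change D.tensorAct E (Coalgebra.comul (((D.deg.fst * E.deg.fst)⁻¹ * g.snd *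
      (D.deg.fst * E.deg.fst) * g.fst⁻¹) x)) m =
      (D.twist g).tensorAct (E.twist g) (Coalgebra.comul x) m
    rw [comul_aut]
    generalize Coalgebra.comul (R := k) x = u
    induction u with
    | zero => simp
    | add u v hu hv => simp only [map_add, LinearMap.add_apply, hu, hv]
    | tmul a b =>
      induction m with
      | zero => exact (map_zero _).trans (map_zero _).symm
      | add s t hs ht =>
        exact (map_add _ s t).trans ((congrArg₂ _ hs ht).trans (map_add _ s t).symm)
      | tmul m n =>
        change D.act _ m ⊗ₜ[k] E.act _ n = D.act _ m ⊗ₜ[k] E.act _ n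
        congr 3 <;> simp [mul_inv_rev]
  · induction m with
    | zero => exact (map_zero _).trans (map_zero _).symm
    | add s t hs ht =>
      exact (map_add _ s t).trans ((congrArg₂ _ hs ht).trans (map_add _ s t).symm)
    | tmul m n =>
      exact lTensor_coactProd ((g.fst * g.snd⁻¹ : H ≃ₐc[k] H) : H →ₐ[k] H) (D.coact m) (E.coact n)

set_option maxRecDepth 1000 in
theorem _root_.IsAntiPair.twist_dual {T T' : H →ₗ[k] H} (hT : IsAntiPair T T')
    (D : YDDatum.{u, v, w} k H) [Module.Finite k D.carrier] (g : AutPair k H) :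
    (D.dual T T').twist g = (D.twist g).dual T T' := by
  refine mk_congr ?_ (fun x f => ?_) fun f => ?_
  · refine (twist_deg (D.dual T T') g).trans ?_
    change g * D.deg⁻¹ * g⁻¹ = (D.twist g).deg⁻¹
    rw [twist_deg]
    group
  · refine LinearMap.ext fun m => ?_
    change f (D.act ((D.deg.snd⁻¹ * D.deg.fst⁻¹) (T' ((D.deg.fst⁻¹⁻¹ * g.snd * D.deg.fst⁻¹ *
      g.fst⁻¹) x))) m) = f (D.act ((D.deg.fst⁻¹ * g.snd * D.deg.fst * g.fst⁻¹)
        (((g.fst * g.snd⁻¹ * D.deg.snd * D.deg.fst⁻¹ * g.snd * D.deg.fst * g.fst⁻¹)⁻¹ *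
          (g.fst * D.deg.fst * g.fst⁻¹)⁻¹) (T' x))) m)
    simp [hT.aut', mul_inv_rev]
  · refine dual_tmul_ext fun m => ?_
    change dualTensorHom k D.carrier H ((autLin (g.fst * g.snd⁻¹)).lTensor _ (D.dualCoact T f)) m =
      dualTensorHom k (D.twist g).carrier H ((D.twist g).dualCoact T f) m
    refine ((dualTensorHom_lTensor _ _ _).trans ?_).trans
      ((D.twist g).dualCoact_eval T f m).symm
    rw [dualCoact_eval, autLin_apply, hT.aut]
    exact congrArg T (pairLeft_lTensor f (autLin (g.fst * g.snd⁻¹)) (D.coact m)).symm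

end YDDatum

namespace YDfd

variable {k : Type u} {H : Type v} [Field k] [Ring H] [HopfAlgebra k H]
  [Fact (Function.Bijective (HopfAlgebra.antipode k (A := H)))]

/-! ### The monoidal category of finite-dimensional objects -/

theorem hom_ext {X Y : YDfd k H} {f g : X ⟶ Y} (h : ∀ x, lin f x = lin g x) : f = g :=
  Hom.ext (LinearMap.ext h)

theorem obj_ext {X Y : YDfd k H} (h : X.datum = Y.datum) : X = Y := by
  cases X
  cases Y
  cases h
  rfl

/-- A morphism of Yetter-Drinfeld modules as a morphism of the category. -/
def homMk {X Y : YDfd k H} (φ : X.datum.carrier →ₗ[k] Y.datum.carrier)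
    (h : X.datum.IsMor Y.datum φ) : X ⟶ Y :=
  Hom.mk φ h

/-- A linear isomorphism which is a morphism, as an isomorphism of the category. -/
def isoMk {X Y : YDfd k H} (e : X.datum.carrier ≃ₗ[k] Y.datum.carrier)
    (h : X.datum.IsMor Y.datum e.toLinearMap) : X ≅ Y where
  hom := homMk e.toLinearMap h
  inv := homMk e.symm.toLinearMap h.symm
  hom_inv_id := hom_ext fun x => e.symm_apply_apply x
  inv_hom_id := hom_ext fun x => e.apply_symm_apply x

theorem isMor_lin {X Y : YDfd k H} (f : X ⟶ Y) : X.datum.IsMor Y.datum (lin f) :=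
  Hom.isMor f

/-- The tensor product of objects. -/
def tensorObj (X Y : YDfd k H) : YDfd k H :=
  ⟨X.datum.tensor Y.datum, X.isYD.tensor Y.isYD, inferInstance⟩

/-- The unit object. -/
def unitObj (k : Type u) (H : Type v) [Field k] [Ring H] [HopfAlgebra k H]
    [Fact (Function.Bijective (HopfAlgebra.antipode k (A := H)))] : YDfd k H :=
  ⟨YDDatum.unit k H, YDDatum.isYD_unit k H, inferInstance⟩

/-- The tensor product of Yetter-Drinfeld modules, with the constraints of vector spaces. -/
scoped instance instMonoidalCategoryStruct : MonoidalCategoryStruct (YDfd k H) where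
  tensorObj := tensorObj
  tensorUnit := unitObj k H
  tensorHom f g := homMk (TensorProduct.map (lin f) (lin g)) ((isMor_lin f).tensor (isMor_lin g))
  whiskerLeft X _ _ g := homMk (TensorProduct.map LinearMap.id (lin g))
    ((YDDatum.isMor_id X.datum).tensor (isMor_lin g))
  whiskerRight f Y := homMk (TensorProduct.map (lin f) LinearMap.id)
    ((isMor_lin f).tensor (YDDatum.isMor_id Y.datum))
  associator X Y Z := isoMk (X := tensorObj (tensorObj X Y) Z) (Y := tensorObj X (tensorObj Y Z))
    (TensorProduct.assoc k X.datum.carrier Y.datum.carrier Z.datum.carrier)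
    (YDDatum.isMor_assoc _ _ _)
  leftUnitor X := isoMk (X := tensorObj (unitObj k H) X)
    (TensorProduct.lid k X.datum.carrier) (YDDatum.isMor_lid _)
  rightUnitor X := isoMk (X := tensorObj X (unitObj k H))
    (TensorProduct.rid k X.datum.carrier) (YDDatum.isMor_rid _)

/-- The axioms hold because they hold for vector spaces. -/
scoped instance instMonoidalCategory : MonoidalCategory (YDfd k H) where
  tensorHom_def f g := Hom.ext (TensorProduct.ext' fun _ _ => rfl)
  id_tensorHom_id X Y := Hom.ext (TensorProduct.ext' fun _ _ => rfl)
  tensorHom_comp_tensorHom f₁ f₂ g₁ g₂ := Hom.ext (TensorProduct.ext' fun _ _ => rfl)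
  whiskerLeft_id X Y := Hom.ext (TensorProduct.ext' fun _ _ => rfl)
  id_whiskerRight X Y := Hom.ext (TensorProduct.ext' fun _ _ => rfl)
  associator_naturality f₁ f₂ f₃ := Hom.ext (TensorProduct.ext_threefold fun _ _ _ => rfl)
  leftUnitor_naturality f :=
    Hom.ext (TensorProduct.ext' fun (c : k) x => ((lin f).map_smul c x).symm)
  rightUnitor_naturality f :=
    Hom.ext (TensorProduct.ext' fun x (c : k) => ((lin f).map_smul c x).symm)
  pentagon W X Y Z := Hom.ext (TensorProduct.ext_fourfold fun _ _ _ _ => rfl)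
  triangle X Y := Hom.ext (TensorProduct.ext_threefold fun x (c : k) y => by
    change x ⊗ₜ[k] (c • y) = (c • x) ⊗ₜ[k] y
    rw [TensorProduct.smul_tmul])

end YDfd

/-! ### Conjugation as a strict tensor functor -/

namespace YDDatum

variable {k : Type u} {H : Type v} [Field k] [Ring H] [HopfAlgebra k H]

/-- Two data have literally the same underlying vector space. Case analysis identifies the two
vector space structures, so that the structure maps of vector spaces on both sides become
heterogeneously equal. -/
inductive SameSpace : YDDatum.{u, v, w} k H → YDDatum.{u, v, w} k H → Prop
  | mk {M : Type w} [AddCommGroup M] [Module k M] (d d' : AutPair k H)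
      (a a' : H →ₗ[k] M →ₗ[k] M) (r r' : M →ₗ[k] M ⊗[k] H) :
      SameSpace ⟨M, d, a, r⟩ ⟨M, d', a', r'⟩

theorem sameSpace_twist (D : YDDatum.{u, v, w} k H) (g : AutPair k H) :
    SameSpace D (D.twist g) :=
  .mk _ _ _ _ _ _

namespace SameSpace

variable {D D' E E' F F' P P' : YDDatum.{u, v, w} k H}

theorem map_heq (hD : SameSpace D D') (hE : SameSpace E E') (hF : SameSpace F F')
    (hP : SameSpace P P') {φ : D.carrier →ₗ[k] E.carrier} {φ' : D'.carrier →ₗ[k] E'.carrier}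
    {ψ : F.carrier →ₗ[k] P.carrier} {ψ' : F'.carrier →ₗ[k] P'.carrier} (hφ : HEq φ φ')
    (hψ : HEq ψ ψ') : HEq (TensorProduct.map φ ψ) (TensorProduct.map φ' ψ') := by
  cases hD
  cases hE
  cases hF
  cases hP
  cases hφ
  cases hψ
  rfl

theorem assoc_heq (hD : SameSpace D D') (hE : SameSpace E E') (hF : SameSpace F F') :
    HEq (TensorProduct.assoc k D.carrier E.carrier F.carrier).toLinearMap
      (TensorProduct.assoc k D'.carrier E'.carrier F'.carrier).toLinearMap := by
  cases hD
  cases hE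
  cases hF
  rfl

theorem lid_heq (hD : SameSpace D D') : HEq (TensorProduct.lid k D.carrier).toLinearMap
    (TensorProduct.lid k D'.carrier).toLinearMap := by
  cases hD
  rfl

theorem rid_heq (hD : SameSpace D D') : HEq (TensorProduct.rid k D.carrier).toLinearMap
    (TensorProduct.rid k D'.carrier).toLinearMap := by
  cases hD
  rfl

theorem leftEv_heq (hD : SameSpace D D') : HEq D.leftEv D'.leftEv := by
  cases hD
  rfl

theorem rightEv_heq (hD : SameSpace D D') : HEq D.rightEv D'.rightEv := by
  cases hD
  rfl

theorem leftCoev_heq [Module.Finite k D.carrier] [Module.Finite k D'.carrier]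
    (hD : SameSpace D D') : HEq D.leftCoev D'.leftCoev := by
  cases hD
  rfl

theorem rightCoev_heq [Module.Finite k D.carrier] [Module.Finite k D'.carrier]
    (hD : SameSpace D D') : HEq D.rightCoev D'.rightCoev := by
  cases hD
  rfl

end SameSpace

end YDDatum

namespace YDfd

variable {k : Type u} {H : Type v} [Field k] [Ring H] [HopfAlgebra k H]
  [Fact (Function.Bijective (HopfAlgebra.antipode k (A := H)))]

/-- Morphisms with the same underlying map agree up to the identity morphisms between equal
objects. -/
theorem eq_eqToHom_comp_eqToHom {X Y X' Y' : YDfd k H} {f : X ⟶ Y} {g : X' ⟶ Y'} (hX : X = X')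
    (hY : Y' = Y) (h : HEq (lin f) (lin g)) : f = eqToHom hX ≫ g ≫ eqToHom hY := by
  subst hX hY
  simpa using Hom.ext (eq_of_heq h)

theorem eq_comp_eqToHom {X Y Y' : YDfd k H} {f : X ⟶ Y} {g : X ⟶ Y'}
    (hY : Y' = Y) (h : HEq (lin f) (lin g)) : f = g ≫ eqToHom hY := by
  subst hY
  simpa using Hom.ext (eq_of_heq h)

theorem eq_eqToHom_comp {X Y X' : YDfd k H} {f : X ⟶ Y} {g : X' ⟶ Y} (hX : X = X')
    (h : HEq (lin f) (lin g)) : f = eqToHom hX ≫ g := by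
  subst hX
  simpa using Hom.ext (eq_of_heq h)

/-- The conjugate `^g N`. -/
def conjObj (g : AutPair k H) (X : YDfd k H) : YDfd k H :=
  ⟨X.datum.twist g, X.isYD.twist g, X.finite⟩

/-- The conjugation `N ↦ ^g N`, the identity on underlying maps. -/
def conj (g : AutPair k H) : YDfd k H ⥤ YDfd k H where
  obj := conjObj g
  map {X Y} f := homMk (X := conjObj g X) (Y := conjObj g Y) (lin (X := X) (Y := Y) f)
    ((isMor_lin f).twist g)
  map_id _ := rfl
  map_comp _ _ := rfl

open YDDatum (sameSpace_twist)

/-- Conjugation does not change the underlying maps. -/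
theorem lin_conj_map_heq (g : AutPair k H) {X Y : YDfd k H} (f : X ⟶ Y) :
    HEq (lin ((conj g).map f)) (lin f) :=
  HEq.rfl

theorem conj_obj_unit (g : AutPair k H) : (conj g).obj (𝟙_ (YDfd k H)) = 𝟙_ (YDfd k H) :=
  obj_ext (YDDatum.twist_unit g)

theorem conj_obj_tensor (g : AutPair k H) (X Y : YDfd k H) :
    (conj g).obj (X ⊗ Y) = (conj g).obj X ⊗ (conj g).obj Y :=
  obj_ext (YDDatum.twist_tensor X.datum Y.datum g)

theorem conj_isStrictTensorFunctor (g : AutPair k H) : IsStrictTensorFunctor (conj g) where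
  obj_unit := conj_obj_unit g
  obj_tensor := conj_obj_tensor g
  map_tensor f f' := eq_eqToHom_comp_eqToHom _ _ <| (lin_conj_map_heq g _).trans <|
    (sameSpace_twist _ g).map_heq (sameSpace_twist _ g) (sameSpace_twist _ g) (sameSpace_twist _ g)
      (lin_conj_map_heq g f).symm (lin_conj_map_heq g f').symm
  map_associator X Y Z := eq_eqToHom_comp_eqToHom _ _ <| (lin_conj_map_heq g _).trans <|
    (sameSpace_twist X.datum g).assoc_heq (sameSpace_twist Y.datum g) (sameSpace_twist Z.datum g)
  map_leftUnitor X := eq_eqToHom_comp _ <| (lin_conj_map_heq g _).trans <|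
    (sameSpace_twist X.datum g).lid_heq
  map_rightUnitor X := eq_eqToHom_comp _ <| (lin_conj_map_heq g _).trans <|
    (sameSpace_twist X.datum g).rid_heq

end YDfd

/-! ### The braided T-category -/

namespace YDDatum

variable {k : Type u} {H : Type v} [Field k] [Ring H] [HopfAlgebra k H]

theorem braid_twist_heq (D E : YDDatum.{u, v, w} k H) (g : AutPair k H) :
    HEq (D.braid E) ((D.twist g).braid (E.twist g)) := by
  -- with explicit data the two types are equal by unfolding
  obtain ⟨M, d, a, r⟩ := D
  obtain ⟨N, d', a', r'⟩ := E
  exact heq_of_eq (LinearMap.ext fun z => (braid_twist ⟨M, d, a, r⟩ ⟨N, d', a', r'⟩ g z).symm)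

theorem braid_comp_map {D D' E E' : YDDatum.{u, v, w} k H} {φ : D.carrier →ₗ[k] D'.carrier}
    {ψ : E.carrier →ₗ[k] E'.carrier} (hφ : IsMor D D' φ) (hψ : IsMor E E' ψ) :
    D'.braid E' ∘ₗ TensorProduct.map φ ψ = TensorProduct.map ψ φ ∘ₗ D.braid E :=
  LinearMap.ext (braid_naturality hφ hψ)

theorem braid_tensor_left_comp {D E F : YDDatum.{u, v, w} k H}
    [Fact (Function.Bijective (HopfAlgebra.antipode k (A := H)))] (hF : F.IsYD) :
    (D.tensor E).braid F =
      (TensorProduct.assoc k F.carrier D.carrier E.carrier).toLinearMap ∘ₗ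
        TensorProduct.map (D.braid (F.twist E.deg)) .id ∘ₗ
          (TensorProduct.assoc k D.carrier F.carrier E.carrier).symm.toLinearMap ∘ₗ
            TensorProduct.map .id (E.braid F) ∘ₗ
              (TensorProduct.assoc k D.carrier E.carrier F.carrier).toLinearMap :=
  LinearMap.ext (braid_tensor_left hF)

theorem braid_tensor_right_comp {D E F : YDDatum.{u, v, w} k H}
    [Fact (Function.Bijective (HopfAlgebra.antipode k (A := H)))] (hD : D.IsYD) :
    D.braid (E.tensor F) =
      (TensorProduct.assoc k E.carrier F.carrier D.carrier).symm.toLinearMap ∘ₗ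
        TensorProduct.map .id (D.braid F) ∘ₗ
          (TensorProduct.assoc k E.carrier D.carrier F.carrier).toLinearMap ∘ₗ
            TensorProduct.map (D.braid E) .id ∘ₗ
              (TensorProduct.assoc k D.carrier E.carrier F.carrier).symm.toLinearMap :=
  LinearMap.ext (braid_tensor_right hD)

end YDDatum

namespace YDfd

variable {k : Type u} {H : Type v} [Field k] [Ring H] [HopfAlgebra k H]
  [Fact (Function.Bijective (HopfAlgebra.antipode k (A := H)))]

theorem conj_one : conj (1 : AutPair k H) = 𝟭 (YDfd k H) :=
  CategoryTheory.Functor.ext (fun X => obj_ext X.datum.twist_one)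
    fun _ _ _ => eq_eqToHom_comp_eqToHom _ _ (lin_conj_map_heq 1 _)

theorem conj_mul (g h : AutPair k H) :
    conj (g * h) = (conj h ⋙ conj g : YDfd k H ⥤ YDfd k H) :=
  CategoryTheory.Functor.ext (fun X => obj_ext (X.datum.twist_mul g h))
    fun _ _ f => eq_eqToHom_comp_eqToHom _ _ <| (lin_conj_map_heq (g * h) f).trans <|
      (lin_conj_map_heq h f).symm.trans (lin_conj_map_heq g ((conj h).map f)).symm

variable (k H) in
/-- The T-category structure: components and conjugation. -/
def tCategory : TCategory (AutPair k H) (YDfd k H) where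
  deg X := X.datum.deg
  deg_eq_of_hom f := (isMor_lin f).deg_eq
  deg_unit := rfl
  deg_tensor _ _ := rfl
  conj := conj
  conj_strict := conj_isStrictTensorFunctor
  conj_one := conj_one
  conj_mul := conj_mul
  deg_conj g X := X.datum.twist_deg g

/-- The braiding `c_{M,N} : M ⊗ N → ^M N ⊗ M`, `m ⊗ n ↦ n₀ ⊗ β⁻¹(n₁) · m`. -/
def braidIso (X Y : YDfd k H) : X ⊗ Y ≅ (conj X.datum.deg).obj Y ⊗ X :=
  isoMk (X := tensorObj X Y) (Y := tensorObj (conjObj X.datum.deg Y) X)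
    (YDDatum.braidEquiv X.isYD Y.isYD) (YDDatum.isMor_braid X.isYD Y.isYD)

theorem braidIso_naturality {X X' Y Y' : YDfd k H} (f : X ⟶ X') (g : Y ⟶ Y') (h) :
    (f ⊗ₘ g) ≫ (braidIso X' Y').hom =
      (braidIso X Y).hom ≫ ((conj X.datum.deg).map g ⊗ₘ f) ≫ eqToHom h := by
  rw [← Category.assoc]
  -- the two composites have equal underlying maps but different targets, so both are compared
  -- with maps between tensor products of the underlying spaces
  have hl : HEq (lin ((f ⊗ₘ g) ≫ (braidIso X' Y').hom))
      (X'.datum.braid Y'.datum ∘ₗ TensorProduct.map (lin f) (lin g)) := HEq.rfl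
  have hr : HEq (TensorProduct.map (lin g) (lin f) ∘ₗ X.datum.braid Y.datum)
      (lin ((braidIso X Y).hom ≫ ((conj X.datum.deg).map g ⊗ₘ f))) := HEq.rfl
  exact eq_comp_eqToHom _ <| hl.trans <|
    (heq_of_eq (YDDatum.braid_comp_map (isMor_lin f) (isMor_lin g))).trans hr

theorem braidIso_tensor_left (X Y Z : YDfd k H) (h) :
    (braidIso (X ⊗ Y) Z).hom =
      (α_ X Y Z).hom ≫ X ◁ (braidIso Y Z).hom ≫ (α_ X ((conj Y.datum.deg).obj Z) Y).inv ≫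
        (braidIso X ((conj Y.datum.deg).obj Z)).hom ▷ Y ≫
          (α_ ((conj X.datum.deg).obj ((conj Y.datum.deg).obj Z)) X Y).hom ≫ eqToHom h := by
  have hl : HEq (lin (braidIso (X ⊗ Y) Z).hom) ((X.datum.tensor Y.datum).braid Z.datum) := HEq.rfl
  have hr : HEq
      ((TensorProduct.assoc k Z.datum.carrier X.datum.carrier Y.datum.carrier).toLinearMap ∘ₗ
        TensorProduct.map (X.datum.braid (Z.datum.twist Y.datum.deg)) .id ∘ₗ
        (TensorProduct.assoc k X.datum.carrier Z.datum.carrier Y.datum.carrier).symm.toLinearMap ∘ₗ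
        TensorProduct.map .id (Y.datum.braid Z.datum) ∘ₗ
        (TensorProduct.assoc k X.datum.carrier Y.datum.carrier Z.datum.carrier).toLinearMap)
      (lin ((α_ X Y Z).hom ≫ X ◁ (braidIso Y Z).hom ≫ (α_ X ((conj Y.datum.deg).obj Z) Y).inv ≫
        (braidIso X ((conj Y.datum.deg).obj Z)).hom ▷ Y ≫
          (α_ ((conj X.datum.deg).obj ((conj Y.datum.deg).obj Z)) X Y).hom)) := HEq.rfl
  simpa only [Category.assoc] using eq_comp_eqToHom h <| hl.trans <|
    (heq_of_eq (YDDatum.braid_tensor_left_comp Z.isYD)).trans hr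

theorem braidIso_tensor_right (X Y Z : YDfd k H) (h) :
    (braidIso X (Y ⊗ Z)).hom =
      (α_ X Y Z).inv ≫ (braidIso X Y).hom ▷ Z ≫ (α_ ((conj X.datum.deg).obj Y) X Z).hom ≫
        (conj X.datum.deg).obj Y ◁ (braidIso X Z).hom ≫
          (α_ ((conj X.datum.deg).obj Y) ((conj X.datum.deg).obj Z) X).inv ≫ eqToHom h := by
  have hl : HEq (lin (braidIso X (Y ⊗ Z)).hom) (X.datum.braid (Y.datum.tensor Z.datum)) := HEq.rfl
  have hr : HEq
      ((TensorProduct.assoc k Y.datum.carrier Z.datum.carrier X.datum.carrier).symm.toLinearMap ∘ₗ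
        TensorProduct.map .id (X.datum.braid Z.datum) ∘ₗ
        (TensorProduct.assoc k Y.datum.carrier X.datum.carrier Z.datum.carrier).toLinearMap ∘ₗ
        TensorProduct.map (X.datum.braid Y.datum) .id ∘ₗ
        (TensorProduct.assoc k X.datum.carrier Y.datum.carrier Z.datum.carrier).symm.toLinearMap)
      (lin ((α_ X Y Z).inv ≫ (braidIso X Y).hom ▷ Z ≫ (α_ ((conj X.datum.deg).obj Y) X Z).hom ≫
        (conj X.datum.deg).obj Y ◁ (braidIso X Z).hom ≫
          (α_ ((conj X.datum.deg).obj Y) ((conj X.datum.deg).obj Z) X).inv)) := HEq.rfl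
  simpa only [Category.assoc] using eq_comp_eqToHom h <| hl.trans <|
    (heq_of_eq (YDDatum.braid_tensor_right_comp X.isYD)).trans hr

theorem lin_braidIso_heq (X Y : YDfd k H) :
    HEq (X.datum.braid Y.datum) (lin (braidIso X Y).hom) :=
  HEq.rfl

theorem conj_map_braidIso (g : AutPair k H) (X Y : YDfd k H) (h h') :
    (conj g).map (braidIso X Y).hom =
      eqToHom h ≫ (braidIso ((conj g).obj X) ((conj g).obj Y)).hom ≫ eqToHom h' :=
  eq_eqToHom_comp_eqToHom _ _ <| (lin_conj_map_heq g _).trans <|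
    (lin_braidIso_heq X Y).symm.trans <| (X.datum.braid_twist_heq Y.datum g).trans <|
      lin_braidIso_heq ((conj g).obj X) ((conj g).obj Y)

variable (k H) in
/-- The braiding of the T-category. -/
def braiding : (tCategory k H).Braiding where
  c := braidIso
  naturality f g := braidIso_naturality f g _
  tensor_left X Y Z := braidIso_tensor_left X Y Z _
  tensor_right X Y Z := braidIso_tensor_right X Y Z _
  conj_c g X Y := conj_map_braidIso g X Y _ _

end YDfd

/-! ### The dualities -/

namespace YDfd

variable {k : Type u} {H : Type v} [Field k] [Ring H] [HopfAlgebra k H]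
  [Fact (Function.Bijective (HopfAlgebra.antipode k (A := H)))]

open YDDatum (sameSpace_twist)

/-- The left dual `M^*`, as an object. -/
def leftDual (X : YDfd k H) : YDfd k H := ⟨X.datum.leftDual, X.isYD.leftDual, inferInstance⟩

/-- The right dual `^*M`, as an object. -/
def rightDual (X : YDfd k H) : YDfd k H := ⟨X.datum.rightDual, X.isYD.rightDual, inferInstance⟩

/-- The pairing of `M` with `M^*`: the coevaluation and evaluation of vector spaces. -/
@[reducible]
def leftPairing (X : YDfd k H) : ExactPairing X (leftDual X) where
  coevaluation' := homMk (Y := tensorObj X (leftDual X)) X.datum.leftCoev X.isYD.isMor_leftCoev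
  evaluation' := homMk (X := tensorObj (leftDual X) X) X.datum.leftEv X.isYD.isMor_leftEv
  coevaluation_evaluation' := (Iso.eq_comp_inv _).2 <| Hom.ext <| TensorProduct.ext <|
    LinearMap.ext fun f => LinearMap.ext_ring <|
      (X.datum.leftZigzag_dual f).trans (one_smul k f).symm
  evaluation_coevaluation' := (Iso.eq_comp_inv _).2 <| Hom.ext <| TensorProduct.ext <|
    LinearMap.ext_ring <| LinearMap.ext fun m =>
      (X.datum.leftZigzag m).trans (one_smul k m).symm

/-- The pairing of `^*M` with `M`: the flipped coevaluation and evaluation of vector spaces. -/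
@[reducible]
def rightPairing (X : YDfd k H) : ExactPairing (rightDual X) X where
  coevaluation' := homMk (Y := tensorObj (rightDual X) X) X.datum.rightCoev X.isYD.isMor_rightCoev
  evaluation' := homMk (X := tensorObj X (rightDual X)) X.datum.rightEv X.isYD.isMor_rightEv
  coevaluation_evaluation' := (Iso.eq_comp_inv _).2 <| Hom.ext <| TensorProduct.ext <|
    LinearMap.ext fun m => LinearMap.ext_ring <|
      (X.datum.rightZigzag m).trans (one_smul k m).symm
  evaluation_coevaluation' := (Iso.eq_comp_inv _).2 <| Hom.ext <| TensorProduct.ext <|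
    LinearMap.ext_ring <| LinearMap.ext fun f =>
      (X.datum.rightZigzag_dual f).trans (one_smul k f).symm

variable (k H) in
/-- The left duality `M ↦ M^*`. -/
def leftDuality : (tCategory k H).LeftDuality where
  dual := leftDual
  pairing := leftPairing
  deg_dual _ := rfl
  conj_dual g X := obj_ext (isAntiPair_antipodeInv.twist_dual X.datum g)
  conj_coev g X := eq_eqToHom_comp_eqToHom _ _ <| (lin_conj_map_heq g _).trans <|
    have := X.finite
    have : Module.Finite k (X.datum.twist g).carrier := X.finite
    (sameSpace_twist X.datum g).leftCoev_heq
  conj_ev g X := eq_eqToHom_comp_eqToHom _ _ <| (lin_conj_map_heq g _).trans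
    (sameSpace_twist X.datum g).leftEv_heq

variable (k H) in
/-- The right duality `M ↦ ^*M`. -/
def rightDuality : (tCategory k H).RightDuality where
  dual := rightDual
  pairing := rightPairing
  deg_dual _ := rfl
  conj_dual g X := obj_ext (isAntiPair_antipode.twist_dual X.datum g)
  conj_coev g X := eq_eqToHom_comp_eqToHom _ _ <| (lin_conj_map_heq g _).trans <|
    have := X.finite
    have : Module.Finite k (X.datum.twist g).carrier := X.finite
    (sameSpace_twist X.datum g).rightCoev_heq
  conj_ev g X := eq_eqToHom_comp_eqToHom _ _ <| (lin_conj_map_heq g _).trans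
    (sameSpace_twist X.datum g).rightEv_heq

end YDfd

end

theorem mainTheorem2 (k : Type u) (H : Type v) [Field k] [Ring H] [HopfAlgebra k H]
    [Fact (Function.Bijective (HopfAlgebra.antipode k (A := H)))] :
    -- left duals
    (∀ (M : YDDatum.{u, v, w} k H) [Module.Finite k M.carrier], M.IsYD →
      M.leftDual.IsYD ∧ M.leftDual.deg = M.deg⁻¹ ∧
      YDDatum.IsMor (YDDatum.unit k H) (M.tensor M.leftDual) M.leftCoev ∧
      YDDatum.IsMor (M.leftDual.tensor M) (YDDatum.unit k H) M.leftEv ∧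
      (∀ m : M.carrier,
        TensorProduct.rid k M.carrier (M.leftEv.lTensor M.carrier
          (TensorProduct.assoc k M.carrier (Module.Dual k M.carrier) M.carrier
            (M.leftCoev.rTensor M.carrier ((1 : k) ⊗ₜ[k] m)))) = m) ∧
      (∀ f : Module.Dual k M.carrier,
        TensorProduct.lid k (Module.Dual k M.carrier) (M.leftEv.rTensor (Module.Dual k M.carrier)
          ((TensorProduct.assoc k (Module.Dual k M.carrier) M.carrier
            (Module.Dual k M.carrier)).symm
            (M.leftCoev.lTensor (Module.Dual k M.carrier) (f ⊗ₜ[k] (1 : k))))) = f)) ∧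
    -- right duals
    (∀ (M : YDDatum.{u, v, w} k H) [Module.Finite k M.carrier], M.IsYD →
      M.rightDual.IsYD ∧ M.rightDual.deg = M.deg⁻¹ ∧
      YDDatum.IsMor (YDDatum.unit k H) (M.rightDual.tensor M) M.rightCoev ∧
      YDDatum.IsMor (M.tensor M.rightDual) (YDDatum.unit k H) M.rightEv ∧
      (∀ m : M.carrier,
        TensorProduct.lid k M.carrier (M.rightEv.rTensor M.carrier
          ((TensorProduct.assoc k M.carrier (Module.Dual k M.carrier) M.carrier).symm
            (M.rightCoev.lTensor M.carrier (m ⊗ₜ[k] (1 : k))))) = m) ∧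
      (∀ f : Module.Dual k M.carrier,
        TensorProduct.rid k (Module.Dual k M.carrier) (M.rightEv.lTensor (Module.Dual k M.carrier)
          (TensorProduct.assoc k (Module.Dual k M.carrier) M.carrier (Module.Dual k M.carrier)
            (M.rightCoev.rTensor (Module.Dual k M.carrier) ((1 : k) ⊗ₜ[k] f)))) = f)) ∧
    -- the braided T-category with left and right dualities
    (∃ (_ : MonoidalCategory (YDfd k H)) (T : TCategory (AutPair k H) (YDfd k H))
        (B : T.Braiding) (L : T.LeftDuality) (R : T.RightDuality),
      -- the tensor product
      (𝟙_ (YDfd k H)).datum = YDDatum.unit k H ∧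
      (∀ X Y : YDfd k H, (X ⊗ Y).datum = X.datum.tensor Y.datum) ∧
      (∀ {X X' Y Y' : YDfd k H} (f : X ⟶ X') (g : Y ⟶ Y'),
        YDfd.IsGivenBy (f ⊗ₘ g) (X.datum.tensor Y.datum) (X'.datum.tensor Y'.datum)
          (TensorProduct.map (YDfd.lin f) (YDfd.lin g))) ∧
      (∀ X Y Z : YDfd k H,
        YDfd.IsGivenBy (α_ X Y Z).hom ((X.datum.tensor Y.datum).tensor Z.datum)
          (X.datum.tensor (Y.datum.tensor Z.datum))
          (TensorProduct.assoc k X.datum.carrier Y.datum.carrier Z.datum.carrier).toLinearMap) ∧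
      (∀ X : YDfd k H,
        YDfd.IsGivenBy (λ_ X).hom ((YDDatum.unit k H).tensor X.datum) X.datum
          (TensorProduct.lid k X.datum.carrier).toLinearMap) ∧
      (∀ X : YDfd k H,
        YDfd.IsGivenBy (ρ_ X).hom (X.datum.tensor (YDDatum.unit k H)) X.datum
          (TensorProduct.rid k X.datum.carrier).toLinearMap) ∧
      -- the components and the conjugation
      (∀ X : YDfd k H, T.deg X = X.datum.deg) ∧
      (∀ (g : AutPair k H) (X : YDfd k H), ((T.conj g).obj X).datum = X.datum.twist g) ∧
      (∀ (g : AutPair k H) {X Y : YDfd k H} (f : X ⟶ Y),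
        YDfd.IsGivenBy ((T.conj g).map f) (X.datum.twist g) (Y.datum.twist g) (YDfd.lin f)) ∧
      -- the braiding
      (∀ X Y : YDfd k H,
        YDfd.IsGivenBy (B.c X Y).hom (X.datum.tensor Y.datum)
          ((Y.datum.twist X.datum.deg).tensor X.datum) (X.datum.braid Y.datum)) ∧
      -- the left duality
      (∀ X : YDfd k H, (L.dual X).datum = X.datum.leftDual) ∧
      (∀ X : YDfd k H,
        YDfd.IsGivenBy (L.pairing X).coevaluation' (YDDatum.unit k H)
          (X.datum.tensor X.datum.leftDual) X.datum.leftCoev) ∧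
      (∀ X : YDfd k H,
        YDfd.IsGivenBy (L.pairing X).evaluation' (X.datum.leftDual.tensor X.datum)
          (YDDatum.unit k H) X.datum.leftEv) ∧
      -- the right duality
      (∀ X : YDfd k H, (R.dual X).datum = X.datum.rightDual) ∧
      (∀ X : YDfd k H,
        YDfd.IsGivenBy (R.pairing X).coevaluation' (YDDatum.unit k H)
          (X.datum.rightDual.tensor X.datum) X.datum.rightCoev) ∧
      (∀ X : YDfd k H,
        YDfd.IsGivenBy (R.pairing X).evaluation' (X.datum.tensor X.datum.rightDual)
          (YDDatum.unit k H) X.datum.rightEv)) :=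
  ⟨fun M _ hM => ⟨hM.leftDual, rfl, hM.isMor_leftCoev, hM.isMor_leftEv, M.leftZigzag,
      M.leftZigzag_dual⟩,
    fun M _ hM => ⟨hM.rightDual, rfl, hM.isMor_rightCoev, hM.isMor_rightEv, M.rightZigzag,
      M.rightZigzag_dual⟩,
    YDfd.instMonoidalCategory, YDfd.tCategory k H, YDfd.braiding k H, YDfd.leftDuality k H,
    YDfd.rightDuality k H, rfl, fun _ _ => rfl, fun _ _ => ⟨rfl, rfl, fun _ => rfl⟩,
    fun _ _ _ => ⟨rfl, rfl, fun _ => rfl⟩, fun _ => ⟨rfl, rfl, fun _ => rfl⟩,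
    fun _ => ⟨rfl, rfl, fun _ => rfl⟩, fun _ => rfl, fun _ _ => rfl,
    fun _ _ _ _ => ⟨rfl, rfl, fun _ => rfl⟩, fun _ _ => ⟨rfl, rfl, fun _ => rfl⟩, fun _ => rfl,
    fun _ => ⟨rfl, rfl, fun _ => rfl⟩, fun _ => ⟨rfl, rfl, fun _ => rfl⟩, fun _ => rfl,
    fun _ => ⟨rfl, rfl, fun _ => rfl⟩, fun _ => ⟨rfl, rfl, fun _ => rfl⟩⟩
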